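/- Fix real constants $\gamma_0>0$, $\lambda>0$, $\eta\in(0,1)$, $s\ge 0$, $C>0$, $C_X>0$, $B\ge 0$ and a function $C_Y:\mathbb{R}\to\mathbb{R}$. Let $n,p$ be integers with $n/p=\gamma_0$, and consider the following setting. (A1) $\Theta\subseteq\mathbb{R}^p$ is closed and convex, and contains a point $\beta_0$ with $\|\beta_0\|^2\le Bp$ and $r_0(\beta_0)\le Bp$, where $r_0$ is as in (A4). (For $B=0$ this says $0\in\Theta$ and $r_0(0)=0$.) (A3) $(x_0,y_0),(x_1,y_1),\dots,(x_n,y_n)\in\mathbb{R}^p\times\mathbb{R}$ are i.i.d., with $x_i\sim N(0,\Sigma)$, where all eigenvalues of $\Sigma$ lie in $[c_X/p,\,C_X/p]$ for some $0<c_X\le C_X$. The conditional law of $y_i$ given $x_i$ is arbitrary. (A4) $r(\beta)=(1-\eta)\,r_0(\beta)+\eta\,\beta^\top\beta$, where $r_0:\mathbb{R}^p\to\mathbb{R}$ is non-negative, convex and Lipschitz continuous. (A5) $\ell,\phi:\mathbb{R}\times\mathbb{R}\to[0,\infty)$ are measurable, and $\ell(y,z)$ and $\phi(y,z)$ are convex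 and continuously differentiable in $z$. With $\dot\ell=\partial_z\ell$ and $\dot\phi=\partial_z\phi$, $$\max\{|\ell(y,z)|,|\dot\ell(y,z)|,|\phi(y,z)|,|\dot\phi(y,z)|\}\le C(1+|y|^s+|z|^s)\quad\text{for all } y,z .$$ Moreover $\mathbb{E}|y_i|^m\le C_Y(m)<\infty$ for all real $m>0$. Let $$\hat\beta=\operatorname*{argmin}_{\beta\in\Theta}\sum_{j=1}^n\ell(y_j,x_j^\top\beta)+\lambda r(\beta),\qquad \hat\beta_{/i}=\operatorname*{argmin}_{\beta\in\Theta}\sum_{j\ne i}\ell(y_j,x_j^\top\beta)+\lambda r(\beta),$$ where the sums run over $1\le j\le n$, and let $$\mathrm{LO}=\frac1n\sum_{i=1}^n\phi(y_i,x_i^\top\hat\beta_{/i}),\qquad \mathrm{OO}=\mathbb{E}\big[\phi(y_0,x_0^\top\hat\beta)\,\big|\,(x_1,y_1),\dots,(x_n,y_n)\big].$$ Then there is a constant $C_v$ depending only on $\gamma_0,\lambda,\eta,s,C,C_X,B$ and $C_Y(\cdot)$ such that in every such setting $(\mathrm{LO}-\mathrm{OO})^2$ is integrable and $$\mathbb{E}(\mathrm{LO}-\mathrm{OO})^2\le\frac{C_v}{n}.$$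 In particular, LO is consistent: along every sequence of such settings, with the same constants and with $n\to\infty$, $\mathrm{LO}-\mathrm{OO}\to0$ in probability. -/

import Mathlib

open MeasureTheory ProbabilityTheory Filter Topology

namespace LeaveOneOut

/-- A feature vector together with its response. -/
abbrev Obs (p : ℕ) : Type := EuclideanSpace ℝ (Fin p) × ℝ

/-- The deterministic ingredients of a regularized estimation problem in dimension `p`:
constraint set, base regularizer, loss, risk function and feature covariance. -/
structure Problem (p : ℕ) where
  /-- the constraint set -/
  Θ : Set (EuclideanSpace ℝ (Fin p))
  /-- the (possibly non-smooth) part of the regularizer -/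
  r₀ : EuclideanSpace ℝ (Fin p) → ℝ
  /-- the loss `ℓ y z` -/
  loss : ℝ → ℝ → ℝ
  /-- the risk function `φ y z` -/
  risk : ℝ → ℝ → ℝ
  /-- the covariance matrix of the features -/
  cov : Matrix (Fin p) (Fin p) ℝ

variable {n p : ℕ} {Ω : Type*}

/-- The regularizer `r(β) = (1 - η) r₀(β) + η βᵀβ`. -/
noncomputable def Problem.regularizer (P : Problem p) (η : ℝ)
    (β : EuclideanSpace ℝ (Fin p)) : ℝ :=
  (1 - η) * P.r₀ β + η * ‖β‖ ^ 2

/-- The penalized empirical risk over the observations of `D` with index in `J`. -/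
noncomputable def Problem.objective (P : Problem p) (lam η : ℝ) (J : Finset (Fin n))
    (D : Fin n → Obs p) (β : EuclideanSpace ℝ (Fin p)) : ℝ :=
  ∑ j ∈ J, P.loss (D j).2 (inner ℝ (D j).1 β) + lam * P.regularizer η β

/-- The regularized empirical risk minimizer over `Θ` based on the observations with index in `J`.
(For nonempty closed convex `Θ` and a convex loss the minimizer exists and is unique,
by strong convexity of the objective.) -/
noncomputable def Problem.estimate (P : Problem p) (lam η : ℝ) (J : Finset (Fin n))
    (D : Fin n → Obs p) : EuclideanSpace ℝ (Fin p) :=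
  Classical.epsilon fun β => β ∈ P.Θ ∧ IsMinOn (P.objective lam η J D) P.Θ β

/-- The training set: observations `1, …, n` of the sample; observation `0` is kept as the
fresh test point. -/
def train (Z : Fin (n + 1) → Ω → Obs p) (ω : Ω) : Fin n → Obs p :=
  fun i => Z i.succ ω

/-- The leave-one-out estimate `(1/n) ∑ i, φ(y i, x iᵀ β_{/i})`. -/
noncomputable def Problem.LO (P : Problem p) (lam η : ℝ) (Z : Fin (n + 1) → Ω → Obs p)
    (ω : Ω) : ℝ :=
  (1 / (n : ℝ)) * ∑ i : Fin n,
    P.risk (train Z ω i).2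
      (inner ℝ (train Z ω i).1 (P.estimate lam η (Finset.univ.erase i) (train Z ω)))

/-- The out-of-sample risk: the conditional expectation of `φ(y₀, x₀ᵀ β)` given the training
set, where `β` is the estimate based on the whole training set. -/
noncomputable def Problem.OO [MeasurableSpace Ω] (P : Problem p) (lam η : ℝ) (μ : Measure Ω)
    (Z : Fin (n + 1) → Ω → Obs p) : Ω → ℝ :=
  μ[fun ω => P.risk (Z 0 ω).2
      (inner ℝ (Z 0 ω).1 (P.estimate lam η Finset.univ (train Z ω)))
    | MeasurableSpace.comap (train Z) inferInstance]

/-- `ℓ(y, z)` is nonnegative, measurable, convex and continuously differentiable in `z`, and it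
and its `z`-derivative are bounded by `C (1 + |y|^s + |z|^s)`. -/
structure AdmissibleLoss (s C : ℝ) (f : ℝ → ℝ → ℝ) : Prop where
  measurable : Measurable (Function.uncurry f)
  nonneg : ∀ y z, 0 ≤ f y z
  convex : ∀ y, ConvexOn ℝ Set.univ (f y)
  contDiff : ∀ y, ContDiff ℝ 1 (f y)
  growth : ∀ y z, |f y z| ≤ C * (1 + |y| ^ s + |z| ^ s)
  growth_deriv : ∀ y z, |deriv (f y) z| ≤ C * (1 + |y| ^ s + |z| ^ s)

/-- The deterministic assumptions. The constraint set contains a point `β₀` with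
`‖β₀‖² ≤ B p` and `r₀ β₀ ≤ B p` (for `B = 0`: the origin, with `r₀ 0 = 0`). -/
structure Problem.Admissible (P : Problem p) (s C C_X B : ℝ) : Prop where
  isClosed : IsClosed P.Θ
  convex : Convex ℝ P.Θ
  anchor : ∃ β₀ ∈ P.Θ, ‖β₀‖ ^ 2 ≤ B * p ∧ P.r₀ β₀ ≤ B * p
  reg_nonneg : ∀ β, 0 ≤ P.r₀ β
  reg_convex : ConvexOn ℝ Set.univ P.r₀
  reg_lipschitz : ∃ K : NNReal, LipschitzWith K P.r₀
  loss : AdmissibleLoss s C P.loss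
  risk : AdmissibleLoss s C P.risk
  cov_posSemidef : P.cov.PosSemidef
  cov_eigenvalues : ∃ c_X : ℝ, 0 < c_X ∧ c_X ≤ C_X ∧
    ∀ i, c_X / p ≤ cov_posSemidef.isHermitian.eigenvalues i ∧
      cov_posSemidef.isHermitian.eigenvalues i ≤ C_X / p

/-- The sample `Z 0, …, Z n` is i.i.d. with centred Gaussian features of covariance `P.cov`,
and the absolute moment of order `m` of the responses is at most `C_Y m`, for all `m > 0`. The
conditional law of the response given the features is arbitrary. -/
structure Problem.IsSample [MeasurableSpace Ω] (P : Problem p) (C_Y : ℝ → ℝ) (μ : Measure Ω)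
    (Z : Fin (n + 1) → Ω → Obs p) : Prop where
  measurable : ∀ i, Measurable (Z i)
  indep : iIndepFun Z μ
  identDistrib : ∀ i, IdentDistrib (Z i) (Z 0) μ μ
  features : ∀ i, HasLaw (fun ω => (Z i ω).1) (multivariateGaussian 0 P.cov) μ
  moments : ∀ i, ∀ m : ℝ, 0 < m →
    Integrable (fun ω => |(Z i ω).2| ^ m) μ ∧ ∫ ω, |(Z i ω).2| ^ m ∂μ ≤ C_Y m

end LeaveOneOut

namespace LeaveOneOut

/-! ### Convexity facts -/

/-! Let `ν` be the law of one observation. Averaging the risk at observation `i` of the estimate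
without `i` over that observation alone gives the mean fresh risk of the same estimate
(`coordAvg_riskAt`). Hence LO − OO = A + R. Here A is the mean over `i` of the fluctuations T_i of
the held-out risks around these averages, and R is the mean of the changes in mean risk when `i` is
put back.

Both parts rest on one stability estimate, `exists_risk_sub_bound`: adding one observation changes
the risk at a fresh point by O(1/p) in mean square. The ridge term makes the objective strongly
convex, so observation `j` moves the estimate by at most a multiple of |ℓ'|·‖x_j‖, which has bounded
moments because ‖x_j‖² = O(1). A fresh Gaussian x₀ is independent of this move Δ and has covariance
at most C_X/p, so x₀ᵀΔ is of order p^(-1/2). Convexity and polynomial growth of the risk turn this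
into a change of risk. The polynomial factors have bounded moments since ‖β‖² = O(p) in every
moment, by comparison with the anchor point. Only strong convexity of the regularizer enters, never
its smoothness.

Jensen's inequality then gives E R² = O(1/n). For A, the n diagonal terms are O(1). In a cross term
E T_i T_j, replace the estimates by the one omitting both `i` and `j`: fluctuations in coordinate
`j` are orthogonal to functions not depending on it, so only the product of the two replacement
errors survives, again O(1/n) (`integral_sq_mean_sub_coordAvg_le`). -/

theorem _root_.ConvexOn.sub_le_deriv_mul {f : ℝ → ℝ} (hf : ConvexOn ℝ Set.univ f)
    (hd : Differentiable ℝ f) (a b : ℝ) : f a - f b ≤ deriv f a * (a - b) := by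
  rcases lt_trichotomy a b with h | h | h
  · have := hf.deriv_le_slope (Set.mem_univ a) (Set.mem_univ b) h (hd a)
    rw [slope_def_field, le_div_iff₀ (by linarith)] at this
    linarith
  · simp [h]
  · have := hf.slope_le_deriv (Set.mem_univ b) (Set.mem_univ a) h (hd a)
    rw [slope_def_field, div_le_iff₀ (by linarith)] at this
    linarith

/-- Compare `a` with points of the segment towards `b`, divide by `t` and let `t → 0`: the full
constant `m / 2` survives, and no differentiability is needed, so a non-smooth `r₀` is allowed. -/
theorem _root_.StrongConvexOn.add_sq_le_of_isMinOn {E : Type*} [NormedAddCommGroup E]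
    [NormedSpace ℝ E] {S : Set E} {m : ℝ} {f : E → ℝ} (hf : StrongConvexOn S m f) {a b : E}
    (ha : a ∈ S) (hb : b ∈ S) (hmin : IsMinOn f S a) :
    f a + m / 2 * ‖b - a‖ ^ 2 ≤ f b := by
  have key : ∀ t ∈ Set.Ioo (0 : ℝ) 1, (1 - t) * (m / 2 * ‖b - a‖ ^ 2) ≤ f b - f a := by
    intro t ht
    have h1 := hf.2 hb ha ht.1.le (sub_nonneg.2 ht.2.le) (by ring)
    have h2 : f a ≤ f (t • b + (1 - t) • a) :=
      hmin (hf.1 hb ha ht.1.le (sub_nonneg.2 ht.2.le) (by ring))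
    simp only [smul_eq_mul] at h1
    have h3 : t * ((1 - t) * (m / 2 * ‖b - a‖ ^ 2)) ≤ t * (f b - f a) := by linarith
    exact le_of_mul_le_mul_left h3 ht.1
  have hlim : Tendsto (fun t : ℝ => (1 - t) * (m / 2 * ‖b - a‖ ^ 2)) (𝓝[>] 0)
      (𝓝 ((1 - 0) * (m / 2 * ‖b - a‖ ^ 2))) :=
    ((continuous_const.sub continuous_id).mul continuous_const).continuousAt.tendsto.mono_left
      nhdsWithin_le_nhds
  have := le_of_tendsto hlim (by
    filter_upwards [Ioo_mem_nhdsGT (zero_lt_one' ℝ)] with t ht using key t ht)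
  linarith

/-- A minimizer with quadratic growth of a Carathéodory function depends measurably on the
parameter. -/
theorem measurable_of_quadratic_growth {α E : Type*} [MeasurableSpace α] [NormedAddCommGroup E]
    [SecondCountableTopology E] [MeasurableSpace E] [BorelSpace E] {S : Set E} (hS : S.Nonempty)
    {f : α → E → ℝ} (hfm : ∀ β, Measurable fun a => f a β) (hfc : ∀ a, Continuous (f a))
    {b : α → E} {c : ℝ} (hc : 0 < c) (hb : ∀ a, b a ∈ S)
    (hgrow : ∀ a, ∀ β ∈ S, f a (b a) + c * ‖β - b a‖ ^ 2 ≤ f a β) : Measurable b := by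
  have : Nonempty S := hS.to_subtype
  let u : ℕ → E := fun k => (TopologicalSpace.denseSeq S k : E)
  have huS : ∀ k, u k ∈ S := fun k => (TopologicalSpace.denseSeq S k).2
  -- `v N a` is the best of the first `N + 1` points of a dense sequence, chosen recursively and
  -- hence measurably. Its values approach the minimum, and quadratic growth forces it to converge
  -- to `b a`.
  let v : ℕ → α → E := fun N => Nat.rec (fun _ => u 0)
    (fun k w a => if f a (u (k + 1)) < f a (w a) then u (k + 1) else w a) N
  have hv0 : ∀ a, v 0 a = u 0 := fun _ => rfl
  have hvs : ∀ k a, v (k + 1) a = if f a (u (k + 1)) < f a (v k a) then u (k + 1) else v k a :=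
    fun _ _ => rfl
  have hjoint : Measurable (Function.uncurry f) := by
    have := measurable_uncurry_of_continuous_of_measurable (u := fun (β : E) (a : α) => f a β)
      (fun a => hfc a) hfm
    exact this.comp measurable_swap
  have hvm : ∀ N, Measurable (v N) := by
    intro N
    induction N with
    | zero => exact measurable_const
    | succ k ih =>
      refine Measurable.ite (measurableSet_lt (hfm _) ?_) measurable_const ih
      exact hjoint.comp (measurable_id.prodMk ih)
  have hvS : ∀ N a, v N a ∈ S := by
    intro N a
    induction N with
    | zero => exact huS 0
    | succ k ih => rw [hvs]; split_ifs; exacts [huS _, ih]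
  have hle : ∀ N a, ∀ k ≤ N, f a (v N a) ≤ f a (u k) := by
    intro N a
    induction N with
    | zero => intro k hk; obtain rfl : k = 0 := by omega
              exact le_rfl
    | succ m ih =>
      intro k hk
      rw [hvs]
      rcases Nat.lt_or_ge k (m + 1) with h | h
      · have := ih k (by omega)
        split_ifs with h'
        exacts [h'.le.trans this, this]
      · obtain rfl : k = m + 1 := by omega
        split_ifs with h'
        exacts [le_rfl, not_lt.1 h']
  refine measurable_of_tendsto_metrizable hvm ?_
  rw [tendsto_pi_nhds]
  intro a
  rw [Metric.tendsto_atTop]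
  intro ε hε
  have hopen : IsOpen {β : S | f a β < f a (b a) + c * ε ^ 2} :=
    isOpen_lt ((hfc a).comp continuous_subtype_val) continuous_const
  obtain ⟨k, hk⟩ := (TopologicalSpace.denseRange_denseSeq S).exists_mem_open hopen
    ⟨⟨b a, hb a⟩, by simp only [Set.mem_ofPred_eq]; have : 0 < c * ε ^ 2 := by positivity
                     linarith⟩
  refine ⟨k, fun N hN => ?_⟩
  have h1 := hgrow a _ (hvS N a)
  have h2 := hle N a k hN
  have h3 : f a (u k) < f a (b a) + c * ε ^ 2 := hk
  rw [dist_eq_norm]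
  have h4 : c * ‖v N a - b a‖ ^ 2 < c * ε ^ 2 := by linarith
  exact lt_of_pow_lt_pow_left₀ 2 hε.le (lt_of_mul_lt_mul_left h4 hc.le)

/-! ### The estimator -/

section Estimator

variable {n p : ℕ} {P : Problem p} {lam η s C C_X B : ℝ}

theorem AdmissibleLoss.differentiable {f : ℝ → ℝ → ℝ} (hf : AdmissibleLoss s C f) (y : ℝ) :
    Differentiable ℝ (f y) := (hf.contDiff y).differentiable one_ne_zero

theorem AdmissibleLoss.continuous {f : ℝ → ℝ → ℝ} (hf : AdmissibleLoss s C f) (y : ℝ) :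
    Continuous (f y) := (hf.contDiff y).continuous

theorem Problem.Admissible.continuous_objective (hP : P.Admissible s C C_X B)
    (J : Finset (Fin n)) (D : Fin n → Obs p) : Continuous (P.objective lam η J D) := by
  obtain ⟨K, hK⟩ := hP.reg_lipschitz
  have := hK.continuous
  unfold Problem.objective Problem.regularizer
  refine Continuous.add (continuous_finsetSum _ fun j _ => ?_) (by fun_prop)
  exact (hP.loss.continuous _).comp (by fun_prop)

/-- All of the modulus comes from the ridge term `lam * η * ‖β‖ ^ 2`; what is left after subtracting
it is convex. -/
theorem Problem.Admissible.strongConvexOn_objective (hP : P.Admissible s C C_X B)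
    (hlam : 0 < lam) (hη : η ∈ Set.Ioo (0 : ℝ) 1) (J : Finset (Fin n)) (D : Fin n → Obs p) :
    StrongConvexOn P.Θ (2 * (lam * η)) (P.objective lam η J D) := by
  rw [strongConvexOn_iff_convex]
  have hsum : ConvexOn ℝ Set.univ fun β : EuclideanSpace ℝ (Fin p) =>
      ∑ j ∈ J, P.loss (D j).2 (inner ℝ (D j).1 β) := by
    have : ∀ j ∈ J, ConvexOn ℝ Set.univ fun β : EuclideanSpace ℝ (Fin p) =>
        P.loss (D j).2 (inner ℝ (D j).1 β) := fun j _ =>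
      (hP.loss.convex (D j).2).comp_linearMap (innerSL ℝ (D j).1).toLinearMap
    induction J using Finset.induction_on with
    | empty => simpa using convexOn_const (0 : ℝ) convex_univ
    | insert a J ha ih =>
      simp only [Finset.sum_insert ha]
      exact (this a (by simp)).add (ih fun j hj => this j (by simp [hj]))
  have hr : ConvexOn ℝ Set.univ fun β => (lam * (1 - η)) * P.r₀ β :=
    hP.reg_convex.smul (mul_nonneg hlam.le (by linarith [hη.2]))
  refine ((hsum.add hr).subset (Set.subset_univ _) hP.convex).congr fun β _ => ?_
  simp only [Problem.objective, Problem.regularizer, Pi.add_apply]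
  ring

theorem Problem.Admissible.le_objective (hP : P.Admissible s C C_X B)
    (hlam : 0 < lam) (hη : η ∈ Set.Ioo (0 : ℝ) 1) (J : Finset (Fin n)) (D : Fin n → Obs p)
    (β : EuclideanSpace ℝ (Fin p)) : lam * η * ‖β‖ ^ 2 ≤ P.objective lam η J D β := by
  have h1 : 0 ≤ ∑ j ∈ J, P.loss (D j).2 (inner ℝ (D j).1 β) :=
    Finset.sum_nonneg fun j _ => hP.loss.nonneg _ _
  have h2 : 0 ≤ lam * ((1 - η) * P.r₀ β) :=
    mul_nonneg hlam.le (mul_nonneg (by linarith [hη.2]) (hP.reg_nonneg β))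
  simp only [Problem.objective, Problem.regularizer]
  linarith

theorem Problem.Admissible.exists_isMinOn (hP : P.Admissible s C C_X B)
    (hlam : 0 < lam) (hη : η ∈ Set.Ioo (0 : ℝ) 1) (J : Finset (Fin n)) (D : Fin n → Obs p) :
    ∃ β, β ∈ P.Θ ∧ IsMinOn (P.objective lam η J D) P.Θ β := by
  obtain ⟨β₀, hβ₀, -⟩ := hP.anchor
  have hpos : 0 < lam * η := mul_pos hlam hη.1
  have hco : Tendsto (P.objective lam η J D) (cocompact _) atTop := by
    refine tendsto_atTop_mono (hP.le_objective hlam hη J D) ?_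
    exact Tendsto.const_mul_atTop hpos
      ((tendsto_pow_atTop two_ne_zero).comp (tendsto_norm_cocompact_atTop))
  obtain ⟨β, h1, h2⟩ := (hP.continuous_objective J D).continuousOn.exists_isMinOn' hP.isClosed hβ₀
    ((hco.eventually (eventually_ge_atTop _)).filter_mono inf_le_left)
  exact ⟨β, h1, h2⟩

theorem Problem.Admissible.estimate_spec (hP : P.Admissible s C C_X B)
    (hlam : 0 < lam) (hη : η ∈ Set.Ioo (0 : ℝ) 1) (J : Finset (Fin n)) (D : Fin n → Obs p) :
    P.estimate lam η J D ∈ P.Θ ∧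
      IsMinOn (P.objective lam η J D) P.Θ (P.estimate lam η J D) :=
  Classical.epsilon_spec (hP.exists_isMinOn hlam hη J D)

theorem Problem.Admissible.objective_estimate_add_le (hP : P.Admissible s C C_X B)
    (hlam : 0 < lam) (hη : η ∈ Set.Ioo (0 : ℝ) 1) (J : Finset (Fin n)) (D : Fin n → Obs p)
    {β : EuclideanSpace ℝ (Fin p)} (hβ : β ∈ P.Θ) :
    P.objective lam η J D (P.estimate lam η J D) +
      lam * η * ‖β - P.estimate lam η J D‖ ^ 2 ≤ P.objective lam η J D β := by
  have h := hP.estimate_spec hlam hη J D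
  have := (hP.strongConvexOn_objective hlam hη J D).add_sq_le_of_isMinOn h.1 hβ h.2
  rwa [mul_div_cancel_left₀ _ (two_ne_zero' ℝ)] at this

/-- The estimate is defined by choice, yet quadratic growth makes the minimizer unique, and so a
limit of measurable selections. -/
theorem Problem.Admissible.measurable_estimate (hP : P.Admissible s C C_X B)
    (hlam : 0 < lam) (hη : η ∈ Set.Ioo (0 : ℝ) 1) (J : Finset (Fin n)) :
    Measurable (P.estimate lam η J) := by
  obtain ⟨β₀, hβ₀, -⟩ := hP.anchor
  refine measurable_of_quadratic_growth ⟨β₀, hβ₀⟩ (f := fun D β => P.objective lam η J D β)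
    (fun β => ?_) (hP.continuous_objective J) (mul_pos hlam hη.1)
    (fun D => (hP.estimate_spec hlam hη J D).1)
    (fun D β hβ => hP.objective_estimate_add_le hlam hη J D hβ)
  unfold Problem.objective
  refine (Finset.measurable_sum _ fun j _ => ?_).add_const _
  have : Measurable fun D : Fin n → Obs p => ((D j).2, inner ℝ (D j).1 β) := by fun_prop
  exact hP.loss.measurable.comp this

/-- This is the form that independence from an omitted observation takes on the product space. The
chosen minimizer depends on the objective only, so the equality is exact. -/
theorem Problem.estimate_update {j : Fin n} {J : Finset (Fin n)} (hj : j ∉ J)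
    (D : Fin n → Obs p) (z : Obs p) :
    P.estimate lam η J (Function.update D j z) = P.estimate lam η J D := by
  have : P.objective lam η J (Function.update D j z) = P.objective lam η J D := by
    ext β
    unfold Problem.objective
    congr 1
    refine Finset.sum_congr rfl fun i hi => ?_
    rw [Function.update_of_ne (by rintro rfl; exact hj hi)]
  unfold Problem.estimate
  rw [this]

/-- Adding one observation moves the estimate by at most a multiple of the gradient of its loss. -/
theorem Problem.Admissible.norm_estimate_sub_le (hP : P.Admissible s C C_X B)
    (hlam : 0 < lam) (hη : η ∈ Set.Ioo (0 : ℝ) 1) {j : Fin n} {J : Finset (Fin n)} (hj : j ∉ J)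
    (D : Fin n → Obs p) :
    ‖P.estimate lam η J D - P.estimate lam η (insert j J) D‖ ≤
      (2 * (lam * η))⁻¹ *
        (|deriv (P.loss (D j).2) (inner ℝ (D j).1 (P.estimate lam η J D))| * ‖(D j).1‖) := by
  set a := P.estimate lam η J D
  set b := P.estimate lam η (insert j J) D
  have hpos : 0 < lam * η := mul_pos hlam hη.1
  -- Adding the two growth inequalities cancels everything except the loss at `j`: `2 * (lam * η) *
  -- ‖a - b‖ ^ 2` is at most its value at `a` minus its value at `b`.
  have h1 := hP.objective_estimate_add_le hlam hη J D (hP.estimate_spec hlam hη (insert j J) D).1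
  have h2 := hP.objective_estimate_add_le hlam hη (insert j J) D (hP.estimate_spec hlam hη J D).1
  change P.objective lam η J D a + lam * η * ‖b - a‖ ^ 2 ≤ P.objective lam η J D b at h1
  change P.objective lam η (insert j J) D b + lam * η * ‖a - b‖ ^ 2 ≤
    P.objective lam η (insert j J) D a at h2
  simp only [Problem.objective, Finset.sum_insert hj] at h1 h2
  rw [norm_sub_rev] at h1
  -- The tangent is taken at `a`, not `b`, because `a` does not depend on observation `j`.
  have h3 := (hP.loss.convex (D j).2).sub_le_deriv_mul (hP.loss.differentiable _)
    (inner ℝ (D j).1 a) (inner ℝ (D j).1 b)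
  rw [← inner_sub_right] at h3
  have h4 : deriv (P.loss (D j).2) (inner ℝ (D j).1 a) * inner ℝ (D j).1 (a - b) ≤
      |deriv (P.loss (D j).2) (inner ℝ (D j).1 a)| * (‖(D j).1‖ * ‖a - b‖) := by
    refine (le_abs_self _).trans ?_
    rw [abs_mul]
    gcongr
    exact abs_real_inner_le_norm _ _
  rw [inv_mul_eq_div, le_div_iff₀ (by positivity)]
  rcases eq_or_lt_of_le (norm_nonneg (a - b)) with h0 | h0
  · rw [← h0, zero_mul]; positivity
  · refine le_of_mul_le_mul_right ?_ h0
    nlinarith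

/-- Compare the minimizer with the anchor point. The sum on the right is extended to all
observations so that the bound does not depend on `J`. -/
theorem Problem.Admissible.estimate_norm_sq_le (hP : P.Admissible s C C_X B)
    (hlam : 0 < lam) (hη : η ∈ Set.Ioo (0 : ℝ) 1) {β₀ : EuclideanSpace ℝ (Fin p)}
    (hβ₀ : β₀ ∈ P.Θ) (hn : ‖β₀‖ ^ 2 ≤ B * p) (hr : P.r₀ β₀ ≤ B * p)
    (J : Finset (Fin n)) (D : Fin n → Obs p) :
    lam * η * ‖P.estimate lam η J D‖ ^ 2 ≤
      ∑ j, P.loss (D j).2 (inner ℝ (D j).1 β₀) + lam * (B * p) := by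
  have h1 := hP.le_objective hlam hη J D (P.estimate lam η J D)
  have h2 := (hP.estimate_spec hlam hη J D).2 hβ₀
  change P.objective lam η J D (P.estimate lam η J D) ≤ P.objective lam η J D β₀ at h2
  have h3 : ∑ j ∈ J, P.loss (D j).2 (inner ℝ (D j).1 β₀) ≤
      ∑ j, P.loss (D j).2 (inner ℝ (D j).1 β₀) :=
    Finset.sum_le_sum_of_subset_of_nonneg (Finset.subset_univ _)
      fun j _ _ => hP.loss.nonneg _ _
  have h4 : P.regularizer η β₀ ≤ B * p := by
    unfold Problem.regularizer
    nlinarith [hη.1, hη.2]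
  have h5 : lam * P.regularizer η β₀ ≤ lam * (B * p) := by gcongr
  unfold Problem.objective at h1 h2
  linarith

end Estimator

/-! ### Upper bounds for integrals of nonnegative functions -/

section LIntegral

variable {α : Type*} [MeasurableSpace α] {μ : Measure α}

/-- Moment bounds are carried as lower integrals of `ENNReal.ofReal`, where sums and Tonelli need no
integrability; integrability and Bochner bounds are extracted only at the end. -/
theorem integrable_of_lintegral_ofReal_le {f : α → ℝ} {K : ℝ} (hf : Measurable f)
    (h0 : ∀ a, 0 ≤ f a) (h : ∫⁻ a, ENNReal.ofReal (f a) ∂μ ≤ ENNReal.ofReal K) :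
    Integrable f μ := by
  refine ⟨hf.aestronglyMeasurable, ?_⟩
  rw [hasFiniteIntegral_iff_ofReal (Eventually.of_forall h0)]
  exact h.trans_lt ENNReal.ofReal_lt_top

theorem integral_le_of_lintegral_ofReal_le {f : α → ℝ} {K : ℝ} (hf : Measurable f) (hK : 0 ≤ K)
    (h0 : ∀ a, 0 ≤ f a) (h : ∫⁻ a, ENNReal.ofReal (f a) ∂μ ≤ ENNReal.ofReal K) :
    ∫ a, f a ∂μ ≤ K := by
  rw [integral_eq_lintegral_of_nonneg_ae (Eventually.of_forall h0) hf.aestronglyMeasurable]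
  exact ENNReal.toReal_le_of_le_ofReal hK h

theorem memLp_two_of_lintegral_sq_le {f : α → ℝ} {K : ℝ} (hf : Measurable f)
    (h : ∫⁻ a, ENNReal.ofReal (f a ^ 2) ∂μ ≤ ENNReal.ofReal K) : MemLp f 2 μ :=
  (memLp_two_iff_integrable_sq hf.aestronglyMeasurable).2
    (integrable_of_lintegral_ofReal_le (hf.pow_const 2) (fun _ => sq_nonneg _) h)

theorem lintegral_ofReal_mono {f g : α → ℝ} (h : ∀ a, f a ≤ g a) :
    ∫⁻ a, ENNReal.ofReal (f a) ∂μ ≤ ∫⁻ a, ENNReal.ofReal (g a) ∂μ :=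
  lintegral_mono fun a => ENNReal.ofReal_le_ofReal (h a)

theorem lintegral_ofReal_add_le {f g : α → ℝ} {K L : ℝ} (hf : Measurable f)
    (hK : 0 ≤ K) (hL : 0 ≤ L)
    (hfK : ∫⁻ a, ENNReal.ofReal (f a) ∂μ ≤ ENNReal.ofReal K)
    (hgL : ∫⁻ a, ENNReal.ofReal (g a) ∂μ ≤ ENNReal.ofReal L) :
    ∫⁻ a, ENNReal.ofReal (f a + g a) ∂μ ≤ ENNReal.ofReal (K + L) := by
  calc ∫⁻ a, ENNReal.ofReal (f a + g a) ∂μ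
      ≤ ∫⁻ a, ENNReal.ofReal (f a) + ENNReal.ofReal (g a) ∂μ :=
        lintegral_mono fun a => ENNReal.ofReal_add_le
    _ = ∫⁻ a, ENNReal.ofReal (f a) ∂μ + ∫⁻ a, ENNReal.ofReal (g a) ∂μ :=
        lintegral_add_left hf.ennreal_ofReal _
    _ ≤ ENNReal.ofReal (K + L) := by
        rw [ENNReal.ofReal_add hK hL]; exact add_le_add hfK hgL

theorem lintegral_ofReal_const_mul_le {f : α → ℝ} {c K : ℝ} (hc : 0 ≤ c)
    (hfK : ∫⁻ a, ENNReal.ofReal (f a) ∂μ ≤ ENNReal.ofReal K) :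
    ∫⁻ a, ENNReal.ofReal (c * f a) ∂μ ≤ ENNReal.ofReal (c * K) := by
  simp only [ENNReal.ofReal_mul hc]
  rw [lintegral_const_mul' _ _ ENNReal.ofReal_ne_top]
  gcongr

theorem lintegral_ofReal_const_le [IsProbabilityMeasure μ] (c : ℝ) :
    ∫⁻ _, ENNReal.ofReal c ∂μ ≤ ENNReal.ofReal c := by simp

theorem lintegral_ofReal_sum_le {ι : Type*} (J : Finset ι) {f : ι → α → ℝ} {K : ι → ℝ}
    (hf : ∀ i, Measurable (f i)) (hK : ∀ i, 0 ≤ K i)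
    (hfK : ∀ i ∈ J, ∫⁻ a, ENNReal.ofReal (f i a) ∂μ ≤ ENNReal.ofReal (K i)) :
    ∫⁻ a, ENNReal.ofReal (∑ i ∈ J, f i a) ∂μ ≤ ENNReal.ofReal (∑ i ∈ J, K i) := by
  classical
  induction J using Finset.induction_on with
  | empty => simp
  | insert i J hi ih =>
    simp only [Finset.sum_insert hi]
    exact lintegral_ofReal_add_le (hf i) (hK i) (Finset.sum_nonneg fun j _ => hK j)
      (hfK i (by simp)) (ih fun j hj => hfK j (by simp [hj]))

/-- Jensen's inequality for the square. -/
theorem ofReal_integral_sq_le [IsProbabilityMeasure μ] {f : α → ℝ} (hf : Measurable f) :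
    ENNReal.ofReal ((∫ a, f a ∂μ) ^ 2) ≤ ∫⁻ a, ENNReal.ofReal (f a ^ 2) ∂μ := by
  have h1 : ‖∫ a, f a ∂μ‖ₑ ≤ eLpNorm f 2 μ := by
    refine (enorm_integral_le_lintegral_enorm f).trans ?_
    rw [← eLpNorm_one_eq_lintegral_enorm]
    exact eLpNorm_le_eLpNorm_of_exponent_le (by norm_num) hf.aestronglyMeasurable
  have h2 : ∀ x : ℝ, ENNReal.ofReal (x ^ 2) = ‖x‖ₑ ^ 2 := fun x => by
    rw [← sq_abs, ENNReal.ofReal_pow (abs_nonneg x), Real.enorm_eq_ofReal_abs]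
  simp only [h2]
  calc _ ≤ eLpNorm f 2 μ ^ 2 := by gcongr
    _ = _ := by
      have := eLpNorm_nnreal_pow_eq_lintegral (f := f) (μ := μ) (p := 2) (by norm_num)
      simpa using this

end LIntegral

/-! ### Resampling one coordinate of a product measure -/

section Resample

variable {n : ℕ} {E : Type*} [MeasurableSpace E] {ν : Measure E}

theorem measurable_update_prod (j : Fin n) :
    Measurable fun q : (Fin n → E) × E => Function.update q.1 j q.2 := by
  rw [measurable_pi_iff]
  intro i
  by_cases h : i = j
  · subst h; simpa using measurable_snd
  · simpa [Function.update_of_ne h] using! (measurable_pi_apply i).comp measurable_fst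

/-- Average over the `j`-th coordinate. -/
noncomputable def coordAvg (ν : Measure E) (j : Fin n) (f : (Fin n → E) → ℝ) (D : Fin n → E) : ℝ :=
  ∫ z, f (Function.update D j z) ∂ν

theorem coordAvg_update (i j : Fin n) {f : (Fin n → E) → ℝ}
    (hf : ∀ D z, f (Function.update D j z) = f D) (D : Fin n → E) (z : E) :
    coordAvg ν i f (Function.update D j z) = coordAvg ν i f D := by
  unfold coordAvg
  congr 1
  ext w
  by_cases h : i = j
  · subst h; simp
  · rw [Function.update_comm (Ne.symm h), hf]

variable [IsProbabilityMeasure ν]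

/-- Replacing one coordinate by an independent copy preserves the product law; it suffices to check
boxes. Every "condition on the other observations" argument goes through this map. -/
theorem measurePreserving_update (j : Fin n) :
    MeasurePreserving (fun q : (Fin n → E) × E => Function.update q.1 j q.2)
      ((Measure.pi fun _ => ν).prod ν) (Measure.pi fun _ => ν) := by
  refine ⟨measurable_update_prod j, ?_⟩
  symm
  refine Measure.pi_eq fun S hS => ?_
  rw [Measure.map_apply (measurable_update_prod j) (.univ_pi hS)]
  have : (fun q : (Fin n → E) × E => Function.update q.1 j q.2) ⁻¹' Set.univ.pi S =
      (Set.univ.pi (Function.update S j Set.univ)) ×ˢ S j := by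
    ext q
    simp only [Set.mem_preimage, Set.mem_univ_pi, Set.mem_prod]
    constructor
    · intro h
      refine ⟨fun i => ?_, by simpa using h j⟩
      by_cases hi : i = j
      · subst hi; simp
      · simpa [hi] using h i
    · rintro ⟨h1, h2⟩ i
      by_cases hi : i = j
      · subst hi; simpa using h2
      · simpa [hi] using h1 i
  rw [this, Measure.prod_prod, Measure.pi_pi, ← Finset.mul_prod_erase _ _ (Finset.mem_univ j),
    ← Finset.mul_prod_erase Finset.univ (fun i => ν (S i)) (Finset.mem_univ j)]
  simp only [Function.update_self, measure_univ, one_mul]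
  rw [mul_comm]
  congr 1
  refine Finset.prod_congr rfl fun i hi => ?_
  rw [Function.update_of_ne (Finset.ne_of_mem_erase hi)]

theorem lintegral_pi_eq_update (j : Fin n) {f : (Fin n → E) → ENNReal} (hf : Measurable f) :
    ∫⁻ D, f D ∂(Measure.pi fun _ => ν) =
      ∫⁻ D, ∫⁻ z, f (Function.update D j z) ∂ν ∂(Measure.pi fun _ => ν) := by
  rw [← (measurePreserving_update j).lintegral_comp hf,
    lintegral_prod (fun q : (Fin n → E) × E => f (Function.update q.1 j q.2))
      (hf.comp (measurable_update_prod j)).aemeasurable]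

theorem measurable_coordAvg (j : Fin n) {f : (Fin n → E) → ℝ} (hf : Measurable f) :
    Measurable (coordAvg ν j f) :=
  (StronglyMeasurable.integral_prod_right
    (f := fun (D : Fin n → E) z => f (Function.update D j z))
    (hf.comp (measurable_update_prod j)).stronglyMeasurable).measurable

theorem lintegral_coordAvg_sq_le (j : Fin n) {f : (Fin n → E) → ℝ} (hf : Measurable f) :
    ∫⁻ D, ENNReal.ofReal (coordAvg ν j f D ^ 2) ∂(Measure.pi fun _ => ν) ≤
      ∫⁻ D, ENNReal.ofReal (f D ^ 2) ∂(Measure.pi fun _ => ν) := by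
  rw [lintegral_pi_eq_update (ν := ν) j (hf.pow_const 2).ennreal_ofReal]
  refine lintegral_mono fun D => ofReal_integral_sq_le ?_
  exact (hf.comp (measurable_update_prod j)).comp measurable_prodMk_left

/-- The factor 4 comes from `(a - b)² ≤ 2 (a² + b²)` and the fact that averaging contracts the L²
norm. -/
theorem lintegral_sub_coordAvg_sq_le (j : Fin n) {f : (Fin n → E) → ℝ} (hf : Measurable f) {K : ℝ}
    (hK : 0 ≤ K)
    (h : ∫⁻ D, ENNReal.ofReal (f D ^ 2) ∂(Measure.pi fun _ => ν) ≤ ENNReal.ofReal K) :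
    ∫⁻ D, ENNReal.ofReal ((f D - coordAvg ν j f D) ^ 2) ∂(Measure.pi fun _ => ν) ≤
      ENNReal.ofReal (4 * K) := by
  have h1 := lintegral_ofReal_const_mul_le (zero_le_two (α := ℝ)) (lintegral_ofReal_add_le
    (hf.pow_const 2) hK hK h ((lintegral_coordAvg_sq_le j hf).trans h))
  refine (lintegral_ofReal_mono fun D => ?_).trans (h1.trans_eq (by ring_nf))
  nlinarith [sq_nonneg (f D + coordAvg ν j f D)]

theorem memLp_coordAvg (j : Fin n) {f : (Fin n → E) → ℝ} (hf : Measurable f)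
    (hf2 : MemLp f 2 (Measure.pi fun _ => ν)) :
    MemLp (coordAvg ν j f) 2 (Measure.pi fun _ => ν) := by
  have h := ((memLp_two_iff_integrable_sq hf.aestronglyMeasurable).1 hf2).2
  rw [hasFiniteIntegral_iff_ofReal (Eventually.of_forall fun _ => sq_nonneg _)] at h
  refine (memLp_two_iff_integrable_sq (measurable_coordAvg j hf).aestronglyMeasurable).2
    ⟨((measurable_coordAvg j hf).pow_const 2).aestronglyMeasurable, ?_⟩
  rw [hasFiniteIntegral_iff_ofReal (Eventually.of_forall fun _ => sq_nonneg _)]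
  exact (lintegral_coordAvg_sq_le j hf).trans_lt h

theorem coordAvg_sub_ae (j : Fin n) {f g : (Fin n → E) → ℝ}
    (hf : Integrable f (Measure.pi fun _ => ν)) (hg : Integrable g (Measure.pi fun _ => ν)) :
    coordAvg ν j (fun D => f D - g D) =ᵐ[Measure.pi fun _ => ν]
      fun D => coordAvg ν j f D - coordAvg ν j g D := by
  have hf' := ((measurePreserving_update j).integrable_comp hf.1).2 hf
  have hg' := ((measurePreserving_update j).integrable_comp hg.1).2 hg
  filter_upwards [hf'.prod_right_ae, hg'.prod_right_ae] with D h1 h2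
  exact integral_sub h1 h2

/-- The fluctuation in the `j`-th coordinate is orthogonal to functions not depending on it. -/
theorem integral_mul_sub_coordAvg (j : Fin n) {g h : (Fin n → E) → ℝ} (hgm : Measurable g)
    (hg : MemLp g 2 (Measure.pi fun _ => ν)) (hh : MemLp h 2 (Measure.pi fun _ => ν))
    (hj : ∀ D z, h (Function.update D j z) = h D) :
    ∫ D, h D * (g D - coordAvg ν j g D) ∂(Measure.pi fun _ => ν) = 0 := by
  have h1 : Integrable (fun D => h D * g D) (Measure.pi fun _ => ν) := hh.integrable_mul hg
  have h2 : Integrable (fun D => h D * coordAvg ν j g D) (Measure.pi fun _ => ν) :=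
    hh.integrable_mul (memLp_coordAvg j hgm hg)
  simp only [mul_sub]
  rw [integral_sub h1 h2, sub_eq_zero]
  have hmp := measurePreserving_update (ν := ν) j
  have h1' : Integrable (fun q : (Fin n → E) × E =>
      h (Function.update q.1 j q.2) * g (Function.update q.1 j q.2))
      ((Measure.pi fun _ => ν).prod ν) := (hmp.integrable_comp h1.1).2 h1
  -- After resampling coordinate `j`, the factor `h` leaves the inner integral, and what remains
  -- inside is the average of `g`.
  have h3 : ∫ D, h D * g D ∂(Measure.pi fun _ => ν) =
      ∫ q : (Fin n → E) × E, h (Function.update q.1 j q.2) * g (Function.update q.1 j q.2)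
        ∂((Measure.pi fun _ => ν).prod ν) := by
    rw [← hmp.map_eq, integral_map hmp.measurable.aemeasurable (hmp.map_eq.symm ▸ h1.1)]
    rw [hmp.map_eq]
  rw [h3, integral_prod _ h1']
  simp only [hj, integral_const_mul]
  rfl

/-- The averages of fluctuations in the different coordinates decorrelate, if the `i`-th function
depends only weakly on the other coordinates. -/
theorem integral_sq_mean_sub_coordAvg_le {F : Fin n → (Fin n → E) → ℝ}
    {F' : Fin n → Fin n → (Fin n → E) → ℝ} {K L : ℝ} (hK : 0 ≤ K) (hL : 0 ≤ L)
    (hF : ∀ i, Measurable (F i)) (hF' : ∀ i j, Measurable (F' i j))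
    (hF2 : ∀ i, ∫⁻ D, ENNReal.ofReal (F i D ^ 2) ∂(Measure.pi fun _ => ν) ≤ ENNReal.ofReal K)
    (hF'2 : ∀ i j, ∫⁻ D, ENNReal.ofReal (F' i j D ^ 2) ∂(Measure.pi fun _ => ν) ≤ ENNReal.ofReal K)
    (hdep : ∀ i j, i ≠ j → ∀ D z, F' i j (Function.update D j z) = F' i j D)
    (hdiff : ∀ i j, i ≠ j →
      ∫⁻ D, ENNReal.ofReal ((F i D - F' i j D) ^ 2) ∂(Measure.pi fun _ => ν) ≤ ENNReal.ofReal L)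
    (hn : n ≠ 0) :
    ∫ D, ((1 / (n : ℝ)) * ∑ i, (F i D - coordAvg ν i (F i) D)) ^ 2 ∂(Measure.pi fun _ => ν) ≤
      4 * K / n + 4 * L := by
  set π : Measure (Fin n → E) := Measure.pi fun _ => ν
  set T : Fin n → (Fin n → E) → ℝ := fun i D => F i D - coordAvg ν i (F i) D
  have hTm : ∀ i, Measurable (T i) := fun i => (hF i).sub (measurable_coordAvg i (hF i))
  have hFL : ∀ i, MemLp (F i) 2 π := fun i => memLp_two_of_lintegral_sq_le (hF i) (hF2 i)
  have hF'L : ∀ i j, MemLp (F' i j) 2 π :=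
    fun i j => memLp_two_of_lintegral_sq_le (hF' i j) (hF'2 i j)
  have hTL : ∀ i, MemLp (T i) 2 π := fun i => (hFL i).sub (memLp_coordAvg i (hF i) (hFL i))
  have hdiag : ∀ i, ∫ D, T i D * T i D ∂π ≤ 4 * K := by
    intro i
    simp only [← sq]
    exact integral_le_of_lintegral_ofReal_le ((hTm i).pow_const 2) (by positivity)
      (fun _ => sq_nonneg _) (lintegral_sub_coordAvg_sq_le i (hF i) hK (hF2 i))
  have hoff : ∀ i j, i ≠ j → ∫ D, T i D * T j D ∂π ≤ 4 * L := by
    intro i j hij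
    -- Split `T i` into the fluctuation `A i j` of the surrogate, free of coordinate `j`, and the
    -- fluctuation `δ i j` of the error. Of the four products in `T i * T j`, the three containing
    -- `A i j` or `A j i` integrate to zero.
    set A : Fin n → Fin n → (Fin n → E) → ℝ := fun i j D => F' i j D - coordAvg ν i (F' i j) D
    set d : Fin n → Fin n → (Fin n → E) → ℝ := fun i j D => F i D - F' i j D
    set δ : Fin n → Fin n → (Fin n → E) → ℝ := fun i j D => d i j D - coordAvg ν i (d i j) D
    have hdm : ∀ i j, Measurable (d i j) := fun i j => (hF i).sub (hF' i j)
    have hdL : ∀ i j, MemLp (d i j) 2 π := fun i j => (hFL i).sub (hF'L i j)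
    have hAL : ∀ i j, MemLp (A i j) 2 π :=
      fun i j => (hF'L i j).sub (memLp_coordAvg i (hF' i j) (hF'L i j))
    have hδL : ∀ i j, MemLp (δ i j) 2 π :=
      fun i j => (hdL i j).sub (memLp_coordAvg i (hdm i j) (hdL i j))
    have hδm : ∀ i j, Measurable (δ i j) :=
      fun i j => (hdm i j).sub (measurable_coordAvg i (hdm i j))
    have hAdep : ∀ i j, i ≠ j → ∀ D z, A i j (Function.update D j z) = A i j D := by
      intro i j hij D z
      simp only [A, hdep i j hij, coordAvg_update i j (hdep i j hij)]
    -- Only almost everywhere: the average of a difference splits where both sections are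
    -- integrable.
    have hT : ∀ i j, T i =ᵐ[π] fun D => A i j D + δ i j D := by
      intro i j
      filter_upwards [coordAvg_sub_ae i ((hFL i).integrable one_le_two)
        ((hF'L i j).integrable one_le_two)] with D hD
      simp only [A, δ, d, T]
      rw [hD]
      ring
    have hδsq : ∀ i j, i ≠ j → ∫ D, δ i j D ^ 2 ∂π ≤ 4 * L := fun i j hij =>
      integral_le_of_lintegral_ofReal_le ((hδm i j).pow_const 2) (by positivity)
        (fun _ => sq_nonneg _) (lintegral_sub_coordAvg_sq_le i (hdm i j) hL (hdiff i j hij))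
    have z1 : ∫ D, A i j D * A j i D ∂π = 0 :=
      integral_mul_sub_coordAvg j (hF' j i) (hF'L j i) (hAL i j) (hAdep i j hij)
    have z2 : ∫ D, A i j D * δ j i D ∂π = 0 :=
      integral_mul_sub_coordAvg j (hdm j i) (hdL j i) (hAL i j) (hAdep i j hij)
    have z3 : ∫ D, A j i D * δ i j D ∂π = 0 :=
      integral_mul_sub_coordAvg i (hdm i j) (hdL i j) (hAL j i) (hAdep j i hij.symm)
    have i1 : Integrable (fun D => A i j D * A j i D) π := (hAL i j).integrable_mul (hAL j i)
    have i2 : Integrable (fun D => A i j D * δ j i D) π := (hAL i j).integrable_mul (hδL j i)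
    have i3 : Integrable (fun D => A j i D * δ i j D) π := (hAL j i).integrable_mul (hδL i j)
    have i4 : Integrable (fun D => δ i j D * δ j i D) π := (hδL i j).integrable_mul (hδL j i)
    have hexp : ∫ D, T i D * T j D ∂π = ∫ D, δ i j D * δ j i D ∂π := by
      calc ∫ D, T i D * T j D ∂π
          = ∫ D, ((A i j D * A j i D + A i j D * δ j i D) + A j i D * δ i j D) +
              δ i j D * δ j i D ∂π := by
            refine integral_congr_ae ?_
            filter_upwards [hT i j, hT j i] with D h1 h2
            rw [h1, h2]; ring
        _ = _ := by
            have i12 : Integrable (fun D => A i j D * A j i D + A i j D * δ j i D) π := i1.add i2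
            have i123 : Integrable (fun D => A i j D * A j i D + A i j D * δ j i D +
              A j i D * δ i j D) π := i12.add i3
            rw [integral_add i123 i4, integral_add i12 i3, integral_add i1 i2, z1, z2, z3]
            ring
    rw [hexp]
    have q1 := (hδL i j).integrable_sq
    have q2 := (hδL j i).integrable_sq
    calc ∫ D, δ i j D * δ j i D ∂π ≤ ∫ D, (1 / 2) * (δ i j D ^ 2 + δ j i D ^ 2) ∂π :=
          integral_mono i4 ((q1.add q2).const_mul _) fun D => by
            simp only
            nlinarith [sq_nonneg (δ i j D - δ j i D)]
      _ ≤ 4 * L := by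
          rw [integral_const_mul, integral_add q1 q2]
          linarith [hδsq i j hij, hδsq j i hij.symm]
  have hexp : ∫ D, ((1 / (n : ℝ)) * ∑ i, T i D) ^ 2 ∂π =
      (1 / (n : ℝ)) ^ 2 * ∑ i, ∑ j, ∫ D, T i D * T j D ∂π := by
    have hint : ∀ i j, Integrable (fun D => T i D * T j D) π :=
      fun i j => (hTL i).integrable_mul (hTL j)
    have : ∀ i, ∑ j, ∫ D, T i D * T j D ∂π = ∫ D, ∑ j, T i D * T j D ∂π :=
      fun i => (integral_finsetSum _ fun j _ => hint i j).symm
    simp only [this]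
    rw [← integral_finsetSum _ fun i _ => integrable_finsetSum _ fun j _ => hint i j,
      ← integral_const_mul]
    simp only [mul_pow, sq (∑ i, T i _), Finset.sum_mul_sum]
  change ∫ D, ((1 / (n : ℝ)) * ∑ i, T i D) ^ 2 ∂π ≤ _
  rw [hexp]
  have hn' : (0 : ℝ) < n := by positivity
  have hsum : ∑ i, ∑ j, ∫ D, T i D * T j D ∂π ≤ n * (4 * K) + n * n * (4 * L) := by
    calc ∑ i, ∑ j, ∫ D, T i D * T j D ∂π
        ≤ ∑ i : Fin n, ∑ j : Fin n, ((if i = j then 4 * K else 0) + 4 * L) := by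
          refine Finset.sum_le_sum fun i _ => Finset.sum_le_sum fun j _ => ?_
          split_ifs with h
          · subst h; linarith [hdiag i]
          · linarith [hoff i j h]
      _ = _ := by
          simp only [Finset.sum_add_distrib, Finset.sum_ite_eq, Finset.mem_univ, if_true,
            Finset.sum_const, Finset.card_univ, Fintype.card_fin, nsmul_eq_mul]
          ring
  calc _ ≤ (1 / (n : ℝ)) ^ 2 * (n * (4 * K) + n * n * (4 * L)) := by gcongr
    _ = _ := by field_simp

end Resample

/-! ### Elementary inequalities -/

theorem add_add_pow_le {a b c : ℝ} (ha : 0 ≤ a) (hb : 0 ≤ b) (hc : 0 ≤ c) (m : ℕ) :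
    (a + b + c) ^ m ≤ 3 ^ m * (a ^ m + b ^ m + c ^ m) := by
  have h1 : a + b + c ≤ 3 * max a (max b c) := by
    have := le_max_left a (max b c)
    have := (le_max_left b c).trans (le_max_right a (max b c))
    have := (le_max_right b c).trans (le_max_right a (max b c))
    linarith
  have ha' := pow_nonneg ha m
  have hb' := pow_nonneg hb m
  have hc' := pow_nonneg hc m
  calc (a + b + c) ^ m ≤ (3 * max a (max b c)) ^ m := by gcongr
    _ = 3 ^ m * max a (max b c) ^ m := mul_pow _ _ _
    _ ≤ _ := by
      gcongr
      rcases max_choice a (max b c) with h | h <;> rw [h]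
      · linarith
      · rcases max_choice b c with h | h <;> rw [h] <;> linarith

/-- The even exponent keeps the dominating polynomial nonnegative without absolute values and
matches the even Gaussian moments. -/
theorem abs_rpow_le_one_add_pow {s : ℝ} (hs : 0 ≤ s) (z : ℝ) :
    |z| ^ s ≤ 1 + z ^ (2 * ⌈s⌉₊) := by
  have h0 : 0 ≤ z ^ (2 * ⌈s⌉₊) := by rw [pow_mul]; positivity
  rcases le_total |z| 1 with h | h
  · exact (Real.rpow_le_one (abs_nonneg z) h hs).trans (by linarith)
  · have h1 : |z| ^ s ≤ |z| ^ ((2 * ⌈s⌉₊ : ℕ) : ℝ) := by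
      refine Real.rpow_le_rpow_of_exponent_le h ?_
      have := Nat.le_ceil s
      push_cast
      linarith
    rw [Real.rpow_natCast, pow_mul, sq_abs, ← pow_mul] at h1
    linarith

/-- The polynomial dominating a loss of polynomial growth of order `s`. -/
noncomputable def envelope (s y z : ℝ) : ℝ := 1 + y ^ (2 * ⌈s⌉₊) + z ^ (2 * ⌈s⌉₊)

theorem even_pow_nonneg (z : ℝ) (k : ℕ) : 0 ≤ z ^ (2 * k) := by rw [pow_mul]; positivity

theorem envelope_pos (s y z : ℝ) : 0 < envelope s y z := by
  have := even_pow_nonneg y ⌈s⌉₊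
  have := even_pow_nonneg z ⌈s⌉₊
  unfold envelope
  linarith

theorem measurable_envelope {α : Type*} [MeasurableSpace α] (s : ℝ) {f g : α → ℝ}
    (hf : Measurable f) (hg : Measurable g) : Measurable fun a => envelope s (f a) (g a) := by
  unfold envelope; fun_prop

theorem envelope_pow_le (s y z : ℝ) (m : ℕ) :
    envelope s y z ^ m ≤ 3 ^ m * (1 + y ^ (2 * (⌈s⌉₊ * m)) + z ^ (2 * (⌈s⌉₊ * m))) := by
  have := add_add_pow_le zero_le_one (even_pow_nonneg y ⌈s⌉₊) (even_pow_nonneg z ⌈s⌉₊) m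
  simpa [envelope, ← pow_mul, mul_assoc] using this

theorem growth_le_envelope {s C : ℝ} (hs : 0 ≤ s) (hC : 0 < C) (y z : ℝ) :
    C * (1 + |y| ^ s + |z| ^ s) ≤ 3 * C * envelope s y z := by
  have h1 := abs_rpow_le_one_add_pow hs y
  have h2 := abs_rpow_le_one_add_pow hs z
  have := even_pow_nonneg y ⌈s⌉₊
  have := even_pow_nonneg z ⌈s⌉₊
  rw [mul_comm 3 C, mul_assoc]
  gcongr
  unfold envelope
  linarith

/-- For a convex function the secant slope lies between the endpoint derivatives, so the envelope is
needed only at `a` and `b`, not at an intermediate point. -/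
theorem AdmissibleLoss.abs_sub_le {s C : ℝ} {f : ℝ → ℝ → ℝ} (hf : AdmissibleLoss s C f)
    (hs : 0 ≤ s) (hC : 0 < C) (y a b : ℝ) :
    |f y a - f y b| ≤ 3 * C * (envelope s y a + envelope s y b) * |a - b| := by
  have h1 := (hf.convex y).sub_le_deriv_mul (hf.differentiable y) a b
  have h2 := (hf.convex y).sub_le_deriv_mul (hf.differentiable y) b a
  have ga := (hf.growth_deriv y a).trans (growth_le_envelope hs hC y a)
  have gb := (hf.growth_deriv y b).trans (growth_le_envelope hs hC y b)
  have ea := envelope_pos s y a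
  have eb := envelope_pos s y b
  have h3 : deriv (f y) a * (a - b) ≤ 3 * C * (envelope s y a + envelope s y b) * |a - b| := by
    refine (le_abs_self _).trans ?_
    rw [abs_mul]
    gcongr
    nlinarith
  have h4 : deriv (f y) b * (b - a) ≤ 3 * C * (envelope s y a + envelope s y b) * |a - b| := by
    refine (le_abs_self _).trans ?_
    rw [abs_mul, abs_sub_comm b a]
    gcongr
    nlinarith
  rw [abs_le]
  constructor <;> linarith

/-- By convexity of the power, an average inherits a common moment bound; the constant is free of
`N` and no independence is required. -/
theorem lintegral_mean_pow_le {α : Type*} [MeasurableSpace α] {μ : Measure α} {N : ℕ}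
    (hN : N ≠ 0) {u : Fin N → α → ℝ} (hu : ∀ i, Measurable (u i)) (hu0 : ∀ i a, 0 ≤ u i a)
    (m : ℕ) {K : ℝ} (hK : 0 ≤ K)
    (h : ∀ i, ∫⁻ a, ENNReal.ofReal (u i a ^ m) ∂μ ≤ ENNReal.ofReal K) :
    ∫⁻ a, ENNReal.ofReal ((∑ i, (1 / (N : ℝ)) * u i a) ^ m) ∂μ ≤ ENNReal.ofReal K := by
  have hN' : (0 : ℝ) < N := by positivity
  have hsum : ∀ c : ℝ, ∑ _i : Fin N, (1 / (N : ℝ)) * c = c := fun c => by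
    simp only [Finset.sum_const, Finset.card_univ, Fintype.card_fin, nsmul_eq_mul]
    field_simp
  calc _ ≤ ∫⁻ a, ENNReal.ofReal (∑ i, (1 / (N : ℝ)) * u i a ^ m) ∂μ :=
        lintegral_ofReal_mono fun a => Real.pow_arith_mean_le_arith_mean_pow _ _ _
          (fun _ _ => by positivity) (by simpa using hsum 1) (fun i _ => hu0 i a) m
    _ ≤ ENNReal.ofReal (∑ _i : Fin N, (1 / (N : ℝ)) * K) :=
        lintegral_ofReal_sum_le _ (fun i => ((hu i).pow_const m).const_mul _)
          (fun _ => by positivity)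
          fun i _ => lintegral_ofReal_const_mul_le (by positivity) (h i)
    _ = _ := by rw [hsum]

/-! ### Gaussian moments -/

/-- The moment of order `2 m` of the standard normal distribution. -/
noncomputable def gaussMoment (m : ℕ) : ℝ := ∫ t, t ^ (2 * m) ∂gaussianReal 0 1

theorem gaussMoment_nonneg (m : ℕ) : 0 ≤ gaussMoment m :=
  integral_nonneg fun t => even_pow_nonneg t m

theorem lintegral_pow_gaussianReal (v : NNReal) (m : ℕ) :
    ∫⁻ t, ENNReal.ofReal (t ^ (2 * m)) ∂gaussianReal 0 v =
      ENNReal.ofReal (gaussMoment m * (v : ℝ) ^ m) := by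
  have h := gaussianReal_map_const_mul (μ := 0) (v := 1) (Real.sqrt v)
  have hv : (NNReal.mk (Real.sqrt v ^ 2) (sq_nonneg _) * 1 : NNReal) = v := by
    ext; simp [Real.sq_sqrt]
  rw [mul_zero, hv] at h
  rw [← h, lintegral_map (by fun_prop) (by fun_prop)]
  have hint : Integrable (fun t : ℝ => t ^ (2 * m)) (gaussianReal 0 1) := by
    have := (memLp_id_gaussianReal (μ := 0) (v := 1) (2 * m : ℕ)).integrable_norm_pow'
    simpa [pow_mul] using this
  have : ∀ t : ℝ, ENNReal.ofReal ((Real.sqrt v * t) ^ (2 * m)) =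
      ENNReal.ofReal ((v : ℝ) ^ m) * ENNReal.ofReal (t ^ (2 * m)) := fun t => by
    rw [mul_pow, ENNReal.ofReal_mul (even_pow_nonneg _ _), pow_mul, Real.sq_sqrt v.coe_nonneg]
  simp only [this]
  rw [lintegral_const_mul _ (by fun_prop), ← ofReal_integral_eq_lintegral_ofReal hint
    (Eventually.of_forall fun t => even_pow_nonneg t m), mul_comm,
    ENNReal.ofReal_mul (gaussMoment_nonneg m)]
  rfl

theorem _root_.Matrix.IsHermitian.dotProduct_mulVec_le {ι : Type*} [Fintype ι] [DecidableEq ι]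
    {S : Matrix ι ι ℝ} (hS : S.IsHermitian) {c : ℝ} (hc : ∀ i, hS.eigenvalues i ≤ c)
    (v : EuclideanSpace ℝ ι) : dotProduct v.ofLp (S.mulVec v.ofLp) ≤ c * ‖v‖ ^ 2 := by
  have hSv : ∀ i, inner ℝ (hS.eigenvectorBasis i) (Matrix.toEuclideanCLM (𝕜 := ℝ) S v) =
      hS.eigenvalues i * inner ℝ (hS.eigenvectorBasis i) v := by
    intro i
    rw [Matrix.inner_toEuclideanCLM, Matrix.dotProduct_mulVec, ← Matrix.mulVec_transpose]
    have hT : S.transpose = S := by simpa [Matrix.IsHermitian] using! hS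
    rw [hT, hS.mulVec_eigenvectorBasis, smul_dotProduct, smul_eq_mul]
    congr 1
    rw [EuclideanSpace.inner_eq_star_dotProduct, dotProduct_comm]
    simp
  rw [← Matrix.inner_toEuclideanCLM, ← hS.eigenvectorBasis.sum_inner_mul_inner,
    ← hS.eigenvectorBasis.sum_sq_inner_right, Finset.mul_sum]
  refine Finset.sum_le_sum fun i _ => ?_
  rw [hSv, real_inner_comm]
  nlinarith [hc i, sq_nonneg (inner ℝ (hS.eigenvectorBasis i) v)]

/-- The distribution of one observation. -/
structure Problem.IsLaw {p : ℕ} (P : Problem p) (C_Y : ℝ → ℝ) (ν : Measure (Obs p)) : Prop where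
  isProbabilityMeasure : IsProbabilityMeasure ν
  features : ν.map Prod.fst = multivariateGaussian 0 P.cov
  moments : ∀ m : ℝ, 0 < m →
    Integrable (fun z : Obs p => |z.2| ^ m) ν ∧ ∫ z, |z.2| ^ m ∂ν ≤ C_Y m

/-- A bound for the response moment of order `2 m`. -/
noncomputable def responseMoment (C_Y : ℝ → ℝ) (m : ℕ) : ℝ := max (C_Y (2 * m)) 1

theorem responseMoment_nonneg (C_Y : ℝ → ℝ) (m : ℕ) : 0 ≤ responseMoment C_Y m :=
  zero_le_one.trans (le_max_right _ _)

section Moments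

variable {n p : ℕ} {P : Problem p} {s C C_X B : ℝ} {C_Y : ℝ → ℝ} {ν : Measure (Obs p)}

theorem Problem.IsLaw.lintegral_response_pow_le (hν : P.IsLaw C_Y ν) (m : ℕ) :
    ∫⁻ z, ENNReal.ofReal (z.2 ^ (2 * m)) ∂ν ≤ ENNReal.ofReal (responseMoment C_Y m) := by
  have := hν.isProbabilityMeasure
  -- The hypothesis covers positive orders only; the maximum with 1 in `responseMoment` takes care
  -- of order 0.
  rcases Nat.eq_zero_or_pos m with rfl | hm
  · simp [responseMoment]
  · obtain ⟨h1, h2⟩ := hν.moments (2 * m) (by positivity)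
    have h3 : ∀ z : Obs p, z.2 ^ (2 * m) = |z.2| ^ (2 * m : ℝ) := fun z => by
      rw [← (even_two_mul m).pow_abs, ← Real.rpow_natCast]
      norm_num
    simp only [h3]
    rw [← ofReal_integral_eq_lintegral_ofReal h1
      (Eventually.of_forall fun z => Real.rpow_nonneg (abs_nonneg _) _)]
    exact ENNReal.ofReal_le_ofReal (h2.trans (le_max_left _ _))

/-- A linear form of a centred Gaussian vector is a centred Gaussian, here with variance `vᵀΣv`, at
most `C_X / p * ‖v‖ ^ 2`. -/
theorem Problem.IsLaw.lintegral_inner_pow_le (hν : P.IsLaw C_Y ν)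
    (hP : P.Admissible s C C_X B) (v : EuclideanSpace ℝ (Fin p)) (m : ℕ) :
    ∫⁻ z, ENNReal.ofReal (inner ℝ z.1 v ^ (2 * m)) ∂ν ≤
      ENNReal.ofReal (gaussMoment m * (C_X / p * ‖v‖ ^ 2) ^ m) := by
  have hL : ν.map (fun z => inner ℝ z.1 v) = gaussianReal 0
      (dotProduct v.ofLp (P.cov.mulVec v.ofLp)).toNNReal := by
    have h1 := IsGaussian.map_eq_gaussianReal (μ := multivariateGaussian 0 P.cov) (innerSL ℝ v)
    have h2 : ∫ x, innerSL ℝ v x ∂(multivariateGaussian 0 P.cov) = 0 := by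
      rw [(innerSL ℝ v).integral_comp_id_comm IsGaussian.integrable_id]
      simp
    have h3 : Var[innerSL ℝ v; multivariateGaussian 0 P.cov] =
        dotProduct v.ofLp (P.cov.mulVec v.ofLp) := by
      rw [← covarianceBilin_multivariateGaussian (μ := 0) hP.cov_posSemidef,
        covarianceBilin_self IsGaussian.memLp_two_id]
      rfl
    rw [h2, h3, ← hν.features, Measure.map_map (by fun_prop) (by fun_prop)] at h1
    rw [← h1]
    congr 1
    ext z
    simp [real_inner_comm]
  have h4 : ∫⁻ z, ENNReal.ofReal (inner ℝ z.1 v ^ (2 * m)) ∂ν =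
      ∫⁻ t, ENNReal.ofReal (t ^ (2 * m)) ∂(ν.map fun z => inner ℝ z.1 v) := by
    rw [lintegral_map (by fun_prop) (by fun_prop)]
  rw [h4, hL, lintegral_pow_gaussianReal]
  obtain ⟨c, -, -, hc⟩ := hP.cov_eigenvalues
  have h5 := hP.cov_posSemidef.isHermitian.dotProduct_mulVec_le (fun i => (hc i).2) v
  have h6 : 0 ≤ dotProduct v.ofLp (P.cov.mulVec v.ofLp) := by
    simpa using hP.cov_posSemidef.dotProduct_mulVec_nonneg v.ofLp
  have := gaussMoment_nonneg m
  rw [Real.coe_toNNReal _ h6]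
  gcongr

/-- The squared norm is the average over coordinates of `p` times the squared coordinate, each with
moments bounded independently of `p`. -/
theorem Problem.IsLaw.lintegral_norm_pow_le (hν : P.IsLaw C_Y ν)
    (hP : P.Admissible s C C_X B) (hC_X : 0 < C_X) (hp : p ≠ 0) (m : ℕ) :
    ∫⁻ z, ENNReal.ofReal ((‖z.1‖ ^ 2) ^ m) ∂ν ≤ ENNReal.ofReal (gaussMoment m * C_X ^ m) := by
  have hp' : (0 : ℝ) < p := by positivity
  have h1 : ∀ z : Obs p, ‖z.1‖ ^ 2 = ∑ l, (1 / (p : ℝ)) *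
      (p * inner ℝ z.1 (EuclideanSpace.single l (1 : ℝ)) ^ 2) := fun z => by
    rw [EuclideanSpace.real_norm_sq_eq]
    refine Finset.sum_congr rfl fun l _ => ?_
    rw [EuclideanSpace.inner_single_right]
    field_simp
    simp
  simp only [h1]
  refine lintegral_mean_pow_le hp (fun l => by fun_prop) (fun l z => by positivity) m
    (mul_nonneg (gaussMoment_nonneg m) (by positivity)) fun l => ?_
  simp only [mul_pow, ← pow_mul]
  refine (lintegral_ofReal_const_mul_le (by positivity)
    (hν.lintegral_inner_pow_le hP (EuclideanSpace.single l (1 : ℝ)) m)).trans_eq ?_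
  congr 1
  rw [show ‖EuclideanSpace.single l (1 : ℝ)‖ = 1 by simp, one_pow, mul_one, div_pow]
  field_simp

variable {α : Type*} [MeasurableSpace α] {ρ : Measure α}

/-- With `a` fixed, the fresh feature is Gaussian. This serves two scales: an estimate of norm O(√p)
has predictions O(1), and an increment of norm O(1) changes them by O(p^(-1/2)). -/
theorem Problem.IsLaw.lintegral_prod_inner_pow_le (hν : P.IsLaw C_Y ν)
    (hP : P.Admissible s C C_X B) (hC_X : 0 < C_X) {b : α → EuclideanSpace ℝ (Fin p)}
    (hb : Measurable b) (m : ℕ) {K : ℝ}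
    (hK : ∫⁻ a, ENNReal.ofReal ((‖b a‖ ^ 2 / p) ^ m) ∂ρ ≤ ENNReal.ofReal K) :
    ∫⁻ q : α × Obs p, ENNReal.ofReal (inner ℝ q.2.1 (b q.1) ^ (2 * m)) ∂(ρ.prod ν) ≤
      ENNReal.ofReal (gaussMoment m * C_X ^ m * K) := by
  have := hν.isProbabilityMeasure
  rw [lintegral_prod _ (by fun_prop)]
  refine (lintegral_mono fun a => hν.lintegral_inner_pow_le hP (b a) m).trans ?_
  have h0 : 0 ≤ gaussMoment m * C_X ^ m := mul_nonneg (gaussMoment_nonneg m) (by positivity)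
  refine le_trans (le_of_eq ?_) (lintegral_ofReal_const_mul_le h0 hK)
  congr 1
  ext a
  congr 1
  rw [mul_assoc, ← mul_pow]
  congr 2
  ring

variable [IsProbabilityMeasure ρ]

theorem Problem.IsLaw.lintegral_prod_response_pow_le (hν : P.IsLaw C_Y ν) (m : ℕ) :
    ∫⁻ q : α × Obs p, ENNReal.ofReal (q.2.2 ^ (2 * m)) ∂(ρ.prod ν) ≤
      ENNReal.ofReal (responseMoment C_Y m) := by
  have := hν.isProbabilityMeasure
  rw [lintegral_prod _ (by fun_prop)]
  simpa using hν.lintegral_response_pow_le m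

theorem Problem.IsLaw.lintegral_prod_norm_pow_le (hν : P.IsLaw C_Y ν)
    (hP : P.Admissible s C C_X B) (hC_X : 0 < C_X) (hp : p ≠ 0) (m : ℕ) :
    ∫⁻ q : α × Obs p, ENNReal.ofReal ((‖q.2.1‖ ^ 2) ^ m) ∂(ρ.prod ν) ≤
      ENNReal.ofReal (gaussMoment m * C_X ^ m) := by
  have := hν.isProbabilityMeasure
  rw [lintegral_prod _ (by fun_prop)]
  simpa using hν.lintegral_norm_pow_le hP hC_X hp m

end Moments

/-! ### Moments of the estimator, uniformly in the dimension -/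

/-- Sign conditions on the parameters. -/
structure ValidParams (γ₀ lam η s C C_X B : ℝ) : Prop where
  ratio_pos : 0 < γ₀
  lam_pos : 0 < lam
  eta_mem : η ∈ Set.Ioo (0 : ℝ) 1
  s_nonneg : 0 ≤ s
  C_pos : 0 < C
  C_X_pos : 0 < C_X
  B_nonneg : 0 ≤ B

/-- A regularized estimation problem with sample size `n`, dimension `p` and observations
distributed according to `ν`. -/
structure Problem.IsSetting (γ₀ s C C_X B : ℝ) (C_Y : ℝ → ℝ) (n : ℕ) {p : ℕ} (P : Problem p)
    (ν : Measure (Obs p)) : Prop where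
  ratio : (n : ℝ) / p = γ₀
  admissible : P.Admissible s C C_X B
  law : P.IsLaw C_Y ν

variable {γ₀ lam η s C C_X B : ℝ} {C_Y : ℝ → ℝ}

/-- Since division by zero gives 0, a positive ratio rules out `p = 0`. -/
theorem Problem.IsSetting.dim_ne_zero {n p : ℕ} {P : Problem p} {ν : Measure (Obs p)}
    (hγ : 0 < γ₀) (h : P.IsSetting γ₀ s C C_X B C_Y n ν) : p ≠ 0 := by
  rintro rfl
  have := h.ratio
  simp at this
  linarith

theorem Problem.IsSetting.sampleSize_ne_zero {n p : ℕ} {P : Problem p} {ν : Measure (Obs p)}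
    (hγ : 0 < γ₀) (h : P.IsSetting γ₀ s C C_X B C_Y n ν) : n ≠ 0 := by
  rintro rfl
  have := h.ratio
  simp at this
  linarith

/-- Writing the bound as an average over observations, with `n = γ₀ * p`, prepares it for
`lintegral_mean_pow_le`. -/
theorem Problem.IsSetting.estimate_norm_sq_div_le (h : ValidParams γ₀ lam η s C C_X B) {n p : ℕ}
    {P : Problem p} {ν : Measure (Obs p)} (hset : P.IsSetting γ₀ s C C_X B C_Y n ν)
    {β₀ : EuclideanSpace ℝ (Fin p)} (hβ₀ : β₀ ∈ P.Θ) (hβn : ‖β₀‖ ^ 2 ≤ B * p)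
    (hβr : P.r₀ β₀ ≤ B * p) (J : Finset (Fin n)) (D : Fin n → Obs p) :
    ‖P.estimate lam η J D‖ ^ 2 / p ≤ ∑ i, (1 / (n : ℝ)) *
      (γ₀ * (3 * C) / (lam * η) * envelope s (D i).2 (inner ℝ (D i).1 β₀) + B / η) := by
  obtain ⟨hγ, hlam, hη, hs, hC, hC_X, hB⟩ := h
  have hη0 := hη.1
  have hp := hset.dim_ne_zero hγ
  have hn := hset.sampleSize_ne_zero hγ
  have hratio := hset.ratio
  have hP := hset.admissible
  have hp' : (0 : ℝ) < p := by positivity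
  have hn' : (0 : ℝ) < n := by positivity
  have h1 := hP.estimate_norm_sq_le hlam hη hβ₀ hβn hβr J D
  have h2 : ∑ j, P.loss (D j).2 (inner ℝ (D j).1 β₀) ≤
      ∑ j, 3 * C * envelope s (D j).2 (inner ℝ (D j).1 β₀) :=
    Finset.sum_le_sum fun j _ => (le_abs_self _).trans
      ((hP.loss.growth _ _).trans (growth_le_envelope hs hC _ _))
  rw [← Finset.mul_sum] at h2
  have hpn : (n : ℝ) = γ₀ * p := by rw [← hratio]; field_simp
  rw [← Finset.mul_sum, Finset.sum_add_distrib, ← Finset.mul_sum]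
  set S := ∑ j, envelope s (D j).2 (inner ℝ (D j).1 β₀)
  simp only [Finset.sum_const, Finset.card_univ, Fintype.card_fin, nsmul_eq_mul]
  have h3 : lam * η * ‖P.estimate lam η J D‖ ^ 2 ≤ 3 * C * S + lam * (B * p) := by linarith
  rw [hpn, div_le_iff₀ hp']
  have h4 : 1 / (γ₀ * p) * (γ₀ * (3 * C) / (lam * η) * S + γ₀ * p * (B / η)) * p =
      (3 * C * S + lam * (B * p)) / (lam * η) := by field_simp
  rw [h4, le_div_iff₀ (by positivity)]
  linarith

theorem Problem.IsLaw.lintegral_envelope_pow_le {p : ℕ} {P : Problem p} {ν : Measure (Obs p)}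
    (hν : P.IsLaw C_Y ν) (hP : P.Admissible s C C_X B) (hC_X : 0 < C_X) (hB : 0 ≤ B) (hp : p ≠ 0)
    {β₀ : EuclideanSpace ℝ (Fin p)} (hβn : ‖β₀‖ ^ 2 ≤ B * p) (m : ℕ) :
    ∫⁻ z, ENNReal.ofReal (envelope s z.2 (inner ℝ z.1 β₀) ^ m) ∂ν ≤
      ENNReal.ofReal (3 ^ m * (1 + responseMoment C_Y (⌈s⌉₊ * m) +
        gaussMoment (⌈s⌉₊ * m) * (C_X * B) ^ (⌈s⌉₊ * m))) := by
  have := hν.isProbabilityMeasure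
  have hp' : (0 : ℝ) < p := by positivity
  have hg := gaussMoment_nonneg (⌈s⌉₊ * m)
  have hr := responseMoment_nonneg C_Y (⌈s⌉₊ * m)
  refine (lintegral_ofReal_mono fun z => envelope_pow_le s _ _ m).trans
    (lintegral_ofReal_const_mul_le (by positivity) ?_)
  refine lintegral_ofReal_add_le (by fun_prop) (by positivity) (by positivity)
    (lintegral_ofReal_add_le (by fun_prop) zero_le_one hr
      (lintegral_ofReal_const_le _) (hν.lintegral_response_pow_le _))
    ((hν.lintegral_inner_pow_le hP β₀ _).trans (ENNReal.ofReal_le_ofReal ?_))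
  have : C_X / p * ‖β₀‖ ^ 2 ≤ C_X * B := by
    rw [div_mul_eq_mul_div, div_le_iff₀ hp', mul_assoc]
    gcongr
  gcongr

theorem exists_estimate_moment_bound (h : ValidParams γ₀ lam η s C C_X B) (C_Y : ℝ → ℝ) (m : ℕ) :
    ∃ K : ℝ, 0 ≤ K ∧ ∀ (n p : ℕ) (P : Problem p) (ν : Measure (Obs p)),
      P.IsSetting γ₀ s C C_X B C_Y n ν → ∀ J : Finset (Fin n),
      ∫⁻ D, ENNReal.ofReal ((‖P.estimate lam η J D‖ ^ 2 / p) ^ m) ∂(Measure.pi fun _ => ν) ≤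
        ENNReal.ofReal K := by
  have hγ := h.ratio_pos
  have hlam := h.lam_pos
  have hη0 := h.eta_mem.1
  have hC := h.C_pos
  have hC_X := h.C_X_pos
  have hB := h.B_nonneg
  obtain ⟨b, hbdef⟩ : ∃ b : ℝ, b = γ₀ * (3 * C) / (lam * η) := ⟨_, rfl⟩
  obtain ⟨a, hadef⟩ : ∃ a : ℝ, a = B / η := ⟨_, rfl⟩
  have hb : 0 ≤ b := by rw [hbdef]; positivity
  have ha : 0 ≤ a := by rw [hadef]; positivity
  have hg := gaussMoment_nonneg (⌈s⌉₊ * m)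
  have hr := responseMoment_nonneg C_Y (⌈s⌉₊ * m)
  obtain ⟨L, hL⟩ : ∃ L : ℝ, L = 3 ^ m * (1 + responseMoment C_Y (⌈s⌉₊ * m) +
        gaussMoment (⌈s⌉₊ * m) * (C_X * B) ^ (⌈s⌉₊ * m)) := ⟨_, rfl⟩
  have hL0 : 0 ≤ L := by rw [hL]; positivity
  refine ⟨2 ^ (m - 1) * (b ^ m * L + a ^ m), by positivity, fun n p P ν hset J => ?_⟩
  have hp := hset.dim_ne_zero hγ
  have hn := hset.sampleSize_ne_zero hγ
  have hP := hset.admissible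
  have hν := hset.law
  have := hν.isProbabilityMeasure
  obtain ⟨β₀, hβ₀, hβn, hβr⟩ := hP.anchor
  have hdet := hset.estimate_norm_sq_div_le h hβ₀ hβn hβr J
  rw [← hbdef, ← hadef] at hdet
  have hmom := hν.lintegral_envelope_pow_le hP hC_X hB hp hβn m
  rw [← hL] at hmom
  have hem : Measurable fun z : Obs p => envelope s z.2 (inner ℝ z.1 β₀) :=
    measurable_envelope s (by fun_prop) (by fun_prop)
  have he0 : ∀ z : Obs p, 0 ≤ b * envelope s z.2 (inner ℝ z.1 β₀) := fun z =>
    mul_nonneg hb (envelope_pos _ _ _).le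
  have hmom' : ∫⁻ z, ENNReal.ofReal ((b * envelope s z.2 (inner ℝ z.1 β₀) + a) ^ m) ∂ν ≤
      ENNReal.ofReal (2 ^ (m - 1) * (b ^ m * L + a ^ m)) := by
    refine (lintegral_ofReal_mono fun z => add_pow_le (he0 z) ha m).trans
      (lintegral_ofReal_const_mul_le (by positivity) ?_)
    simp only [mul_pow]
    exact lintegral_ofReal_add_le (by fun_prop) (by positivity) (by positivity)
      (lintegral_ofReal_const_mul_le (by positivity) hmom) (lintegral_ofReal_const_le _)
  refine (lintegral_ofReal_mono fun D => pow_le_pow_left₀ (by positivity) (hdet D) m).trans ?_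
  have hK0 : 0 ≤ 2 ^ (m - 1) * (b ^ m * L + a ^ m) := by positivity
  have hum : ∀ i : Fin n, Measurable fun D : Fin n → Obs p =>
      b * envelope s (D i).2 (inner ℝ (D i).1 β₀) + a := fun i =>
    (measurable_envelope s (by fun_prop) (by fun_prop)).const_mul b |>.add_const a
  have hui : ∀ i : Fin n, ∫⁻ D : Fin n → Obs p, ENNReal.ofReal
      ((b * envelope s (D i).2 (inner ℝ (D i).1 β₀) + a) ^ m) ∂(Measure.pi fun _ => ν) ≤
      ENNReal.ofReal (2 ^ (m - 1) * (b ^ m * L + a ^ m)) := fun i =>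
    ((measurePreserving_eval (fun _ : Fin n => ν) i).lintegral_comp
      (f := fun z => ENNReal.ofReal ((b * envelope s z.2 (inner ℝ z.1 β₀) + a) ^ m))
      (by fun_prop)).trans_le hmom'
  exact lintegral_mean_pow_le hn hum (fun i D => add_nonneg (he0 _) ha) m hK0 hui

theorem exists_envelope_moment_bound (h : ValidParams γ₀ lam η s C C_X B) (C_Y : ℝ → ℝ) (m : ℕ) :
    ∃ K : ℝ, 0 ≤ K ∧ ∀ (n p : ℕ) (P : Problem p) (ν : Measure (Obs p)),
      P.IsSetting γ₀ s C C_X B C_Y n ν → ∀ J : Finset (Fin n),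
      ∫⁻ q : (Fin n → Obs p) × Obs p, ENNReal.ofReal
        (envelope s q.2.2 (inner ℝ q.2.1 (P.estimate lam η J q.1)) ^ m)
          ∂((Measure.pi fun _ => ν).prod ν) ≤ ENNReal.ofReal K := by
  obtain ⟨K, hK0, hK⟩ := exists_estimate_moment_bound h C_Y (⌈s⌉₊ * m)
  set k := ⌈s⌉₊
  have hg := gaussMoment_nonneg (k * m)
  have hr := responseMoment_nonneg C_Y (k * m)
  have hC_X := h.C_X_pos
  refine ⟨3 ^ m * (1 + responseMoment C_Y (k * m) + gaussMoment (k * m) * C_X ^ (k * m) * K),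
    by positivity, fun n p P ν hset J => ?_⟩
  have hK' := hK n p P ν hset J
  obtain ⟨-, hP, hν⟩ := hset
  have := hν.isProbabilityMeasure
  have hm := hP.measurable_estimate h.lam_pos h.eta_mem J
  refine (lintegral_ofReal_mono fun q => envelope_pow_le s _ _ m).trans
    (lintegral_ofReal_const_mul_le (by positivity) ?_)
  exact lintegral_ofReal_add_le (by fun_prop) (by positivity) (by positivity)
    (lintegral_ofReal_add_le (by fun_prop) (by positivity) (by positivity)
      (lintegral_ofReal_const_le _) (hν.lintegral_prod_response_pow_le _))
    (hν.lintegral_prod_inner_pow_le hP hC_X hm _ hK')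

/-- Resampling observation `j` leaves the estimate on `J` unchanged, so the stability bound is an
envelope at a fresh point times the norm of a fresh feature. The increment is O(1), although the
estimates themselves may have norm of order √p. -/
theorem exists_estimate_sub_moment_bound (h : ValidParams γ₀ lam η s C C_X B) (C_Y : ℝ → ℝ) :
    ∃ K : ℝ, 0 ≤ K ∧ ∀ (n p : ℕ) (P : Problem p) (ν : Measure (Obs p)),
      P.IsSetting γ₀ s C C_X B C_Y n ν → ∀ (J : Finset (Fin n)) (j : Fin n), j ∉ J →
      ∫⁻ D, ENNReal.ofReal (‖P.estimate lam η J D - P.estimate lam η (insert j J) D‖ ^ 4)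
        ∂(Measure.pi fun _ => ν) ≤ ENNReal.ofReal K := by
  obtain ⟨K, hK0, hK⟩ := exists_envelope_moment_bound h C_Y 8
  have hg := gaussMoment_nonneg 4
  obtain ⟨hγ, hlam, hη, hs, hC, hC_X, hB⟩ := h
  have hη0 := hη.1
  -- The half, and the eighth moment of the envelope, come from `2 e⁴‖x‖⁴ ≤ e⁸ + ‖x‖⁸`.
  set c : ℝ := ((2 * (lam * η))⁻¹ * (3 * C)) ^ 4 / 2
  refine ⟨c * (K + gaussMoment 4 * C_X ^ 4), by positivity, fun n p P ν hset J j hj => ?_⟩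
  have hK' := hK n p P ν hset J
  have hp := hset.dim_ne_zero hγ
  obtain ⟨-, hP, hν⟩ := hset
  have := hν.isProbabilityMeasure
  have hmJ := hP.measurable_estimate hlam hη J
  have hmJ' := hP.measurable_estimate hlam hη (insert j J)
  have hme : Measurable fun q : (Fin n → Obs p) × Obs p =>
      envelope s q.2.2 (inner ℝ q.2.1 (P.estimate lam η J q.1)) :=
    measurable_envelope s (by fun_prop) (by fun_prop)
  have hdet : ∀ (D : Fin n → Obs p) (z : Obs p),
      ‖P.estimate lam η J (Function.update D j z) -
        P.estimate lam η (insert j J) (Function.update D j z)‖ ^ 4 ≤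
      c * (envelope s z.2 (inner ℝ z.1 (P.estimate lam η J D)) ^ 8 + (‖z.1‖ ^ 2) ^ 4) := by
    intro D z
    have h1 := hP.norm_estimate_sub_le hlam hη hj (Function.update D j z)
    have h2 := (hP.loss.growth_deriv z.2 (inner ℝ z.1 (P.estimate lam η J D))).trans
      (growth_le_envelope hs hC _ _)
    rw [Function.update_self, Problem.estimate_update hj] at h1
    set e := envelope s z.2 (inner ℝ z.1 (P.estimate lam η J D))
    have he : 0 < e := envelope_pos _ _ _
    rw [Problem.estimate_update hj]
    calc _ ≤ ((2 * (lam * η))⁻¹ * (3 * C * e * ‖z.1‖)) ^ 4 := by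
          refine pow_le_pow_left₀ (norm_nonneg _) (h1.trans ?_) 4
          gcongr
      _ = 2 * c * (e ^ 4 * ‖z.1‖ ^ 4) := by simp only [c]; ring
      _ ≤ c * (e ^ 8 + (‖z.1‖ ^ 2) ^ 4) := by
          have hc : 0 ≤ c := by positivity
          nlinarith [mul_nonneg hc (sq_nonneg (e ^ 4 - ‖z.1‖ ^ 4))]
  rw [lintegral_pi_eq_update j (by fun_prop)]
  refine (lintegral_mono fun D => lintegral_ofReal_mono (hdet D)).trans ?_
  rw [← lintegral_prod (fun q : (Fin n → Obs p) × Obs p => ENNReal.ofReal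
    (c * (envelope s q.2.2 (inner ℝ q.2.1 (P.estimate lam η J q.1)) ^ 8 + (‖q.2.1‖ ^ 2) ^ 4)))
    (by fun_prop)]
  exact lintegral_ofReal_const_mul_le (by positivity) (lintegral_ofReal_add_le (by fun_prop) hK0
    (by positivity) hK' (hν.lintegral_prod_norm_pow_le hP hC_X hp 4))

/-- On a fresh observation, the risks of estimates based on samples which differ by a single
observation differ by `O(p⁻¹)` in mean square. -/
theorem exists_risk_sub_bound (h : ValidParams γ₀ lam η s C C_X B) (C_Y : ℝ → ℝ) :
    ∃ K : ℝ, 0 ≤ K ∧ ∀ (n p : ℕ) (P : Problem p) (ν : Measure (Obs p)),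
      P.IsSetting γ₀ s C C_X B C_Y n ν → ∀ (J : Finset (Fin n)) (j : Fin n), j ∉ J →
      ∫⁻ q : (Fin n → Obs p) × Obs p, ENNReal.ofReal
        ((P.risk q.2.2 (inner ℝ q.2.1 (P.estimate lam η J q.1)) -
          P.risk q.2.2 (inner ℝ q.2.1 (P.estimate lam η (insert j J) q.1))) ^ 2)
          ∂((Measure.pi fun _ => ν).prod ν) ≤ ENNReal.ofReal (K / n) := by
  obtain ⟨K₁, hK₁0, hK₁⟩ := exists_envelope_moment_bound h C_Y 4
  obtain ⟨K₂, hK₂0, hK₂⟩ := exists_estimate_sub_moment_bound h C_Y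
  have hg := gaussMoment_nonneg 2
  obtain ⟨hγ, hlam, hη, hs, hC, hC_X, hB⟩ := h
  -- Here 4 is half of the 8 in `(e + e')⁴ ≤ 8 (e⁴ + e'⁴)`. The leading `γ₀` in the witness below
  -- converts `1 / p` into `1 / n`.
  set c : ℝ := (3 * C) ^ 4 * 4
  refine ⟨γ₀ * (c * (K₁ + K₁) + 1 / 2 * (gaussMoment 2 * C_X ^ 2 * K₂)), by positivity,
    fun n p P ν hset J j hj => ?_⟩
  have hJ := hK₁ n p P ν hset J
  have hJ' := hK₁ n p P ν hset (insert j J)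
  have hΔ := hK₂ n p P ν hset J j hj
  have hp := hset.dim_ne_zero hγ
  have hn := hset.sampleSize_ne_zero hγ
  have hratio := hset.ratio
  obtain ⟨-, hP, hν⟩ := hset
  have := hν.isProbabilityMeasure
  have hp' : (0 : ℝ) < p := by positivity
  have hn' : (0 : ℝ) < n := by positivity
  have hmJ := hP.measurable_estimate hlam hη J
  have hmJ' := hP.measurable_estimate hlam hη (insert j J)
  have hme : ∀ J : Finset (Fin n), Measurable fun q : (Fin n → Obs p) × Obs p =>
      envelope s q.2.2 (inner ℝ q.2.1 (P.estimate lam η J q.1)) := fun J => by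
    have := hP.measurable_estimate hlam hη J
    exact measurable_envelope s (by fun_prop) (by fun_prop)
  have hin : ∫⁻ q : (Fin n → Obs p) × Obs p, ENNReal.ofReal (inner ℝ q.2.1
      (P.estimate lam η J q.1 - P.estimate lam η (insert j J) q.1) ^ (2 * 2))
      ∂((Measure.pi fun _ => ν).prod ν) ≤
      ENNReal.ofReal (gaussMoment 2 * C_X ^ 2 * ((1 / (p : ℝ)) ^ 2 * K₂)) := by
    refine hν.lintegral_prod_inner_pow_le hP hC_X (b := fun D => P.estimate lam η J D -
      P.estimate lam η (insert j J) D) (by fun_prop) 2 ?_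
    refine le_trans (le_of_eq ?_) (lintegral_ofReal_const_mul_le (by positivity) hΔ)
    congr 1
    ext D
    congr 1
    ring
  have hdet : ∀ q : (Fin n → Obs p) × Obs p,
      (P.risk q.2.2 (inner ℝ q.2.1 (P.estimate lam η J q.1)) -
          P.risk q.2.2 (inner ℝ q.2.1 (P.estimate lam η (insert j J) q.1))) ^ 2 ≤
      c / p * (envelope s q.2.2 (inner ℝ q.2.1 (P.estimate lam η J q.1)) ^ 4 +
        envelope s q.2.2 (inner ℝ q.2.1 (P.estimate lam η (insert j J) q.1)) ^ 4) +
      p / 2 * inner ℝ q.2.1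
        (P.estimate lam η J q.1 - P.estimate lam η (insert j J) q.1) ^ (2 * 2) := by
    intro q
    have h1 := hP.risk.abs_sub_le hs hC q.2.2 (inner ℝ q.2.1 (P.estimate lam η J q.1))
      (inner ℝ q.2.1 (P.estimate lam η (insert j J) q.1))
    rw [← inner_sub_right] at h1
    set e := envelope s q.2.2 (inner ℝ q.2.1 (P.estimate lam η J q.1))
    set e' := envelope s q.2.2 (inner ℝ q.2.1 (P.estimate lam η (insert j J) q.1))
    set t : ℝ := inner ℝ q.2.1 (P.estimate lam η J q.1 - P.estimate lam η (insert j J) q.1)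
    have he : 0 < e := envelope_pos _ _ _
    have he' : 0 < e' := envelope_pos _ _ _
    calc _ = |P.risk q.2.2 (inner ℝ q.2.1 (P.estimate lam η J q.1)) -
          P.risk q.2.2 (inner ℝ q.2.1 (P.estimate lam η (insert j J) q.1))| ^ 2 := (sq_abs _).symm
      _ ≤ (3 * C * (e + e') * |t|) ^ 2 := pow_le_pow_left₀ (abs_nonneg _) h1 2
      _ = (3 * C * (e + e')) ^ 2 * t ^ 2 := by rw [mul_pow, sq_abs]
      -- The weight `p` balances the two terms: `t ^ 4` has mean O(p⁻²), so both are O(p⁻¹).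
      _ ≤ 1 / 2 * ((3 * C * (e + e')) ^ 4 / p + p * t ^ 4) := by
          have : 0 ≤ ((3 * C * (e + e')) ^ 2 - p * t ^ 2) ^ 2 / p := by positivity
          have h2 : ((3 * C * (e + e')) ^ 2 - p * t ^ 2) ^ 2 / p =
              (3 * C * (e + e')) ^ 4 / p + p * t ^ 4 - 2 * ((3 * C * (e + e')) ^ 2 * t ^ 2) := by
            field_simp
            ring
          linarith
      _ ≤ _ := by
          have h3 := add_pow_le he.le he'.le 4
          norm_num at h3
          have h4 : (3 * C * (e + e')) ^ 4 / p ≤ 2 * (c / p * (e ^ 4 + e' ^ 4)) := by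
            have : (3 * C) ^ 4 * (e + e') ^ 4 ≤ (3 * C) ^ 4 * (8 * (e ^ 4 + e' ^ 4)) := by gcongr
            rw [mul_pow,
              show 2 * (c / p * (e ^ 4 + e' ^ 4)) = 2 * (c * (e ^ 4 + e' ^ 4)) / p by ring]
            refine div_le_div_of_nonneg_right ?_ hp'.le
            simp only [c]
            linarith
          norm_num
          linarith
  refine (lintegral_ofReal_mono hdet).trans ?_
  have hm1 := hme J
  have hm2 := hme (insert j J)
  refine (lintegral_ofReal_add_le (by fun_prop) (by positivity) (by positivity)
    (lintegral_ofReal_const_mul_le (by positivity)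
      (lintegral_ofReal_add_le (by fun_prop) hK₁0 hK₁0 hJ hJ'))
    (lintegral_ofReal_const_mul_le (by positivity) hin)).trans_eq ?_
  congr 1
  rw [← hratio]
  field_simp

theorem exists_risk_moment_bound (h : ValidParams γ₀ lam η s C C_X B) (C_Y : ℝ → ℝ) :
    ∃ K : ℝ, 0 ≤ K ∧ ∀ (n p : ℕ) (P : Problem p) (ν : Measure (Obs p)),
      P.IsSetting γ₀ s C C_X B C_Y n ν → ∀ J : Finset (Fin n),
      ∫⁻ q : (Fin n → Obs p) × Obs p, ENNReal.ofReal
        (P.risk q.2.2 (inner ℝ q.2.1 (P.estimate lam η J q.1)) ^ 2)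
          ∂((Measure.pi fun _ => ν).prod ν) ≤ ENNReal.ofReal K := by
  obtain ⟨K, hK0, hK⟩ := exists_envelope_moment_bound h C_Y 2
  obtain ⟨hγ, hlam, hη, hs, hC, hC_X, hB⟩ := h
  refine ⟨(3 * C) ^ 2 * K, by positivity, fun n p P ν hset J => ?_⟩
  refine (lintegral_ofReal_mono fun q => ?_).trans
    (lintegral_ofReal_const_mul_le (by positivity) (hK n p P ν hset J))
  rw [← mul_pow]
  exact pow_le_pow_left₀ (hset.admissible.risk.nonneg _ _) ((le_abs_self _).trans
    ((hset.admissible.risk.growth _ _).trans (growth_le_envelope hs hC _ _))) 2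

/-! ### The leave-one-out error on the product space -/

section ProductSpace

variable {n p : ℕ}

/-- The risk at observation `i` of the estimate based on the observations in `J`. -/
noncomputable def Problem.riskAt (P : Problem p) (lam η : ℝ) (J : Finset (Fin n)) (i : Fin n)
    (D : Fin n → Obs p) : ℝ :=
  P.risk (D i).2 (inner ℝ (D i).1 (P.estimate lam η J D))

/-- The risk on a fresh observation of the estimate based on the observations in `J`. -/
noncomputable def Problem.freshRisk (P : Problem p) (lam η : ℝ) (J : Finset (Fin n))
    (q : (Fin n → Obs p) × Obs p) : ℝ :=
  P.risk q.2.2 (inner ℝ q.2.1 (P.estimate lam η J q.1))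

/-- The expected risk on a fresh observation of the estimate based on the observations in `J`. -/
noncomputable def Problem.meanRisk (P : Problem p) (lam η : ℝ) (ν : Measure (Obs p))
    (J : Finset (Fin n)) (D : Fin n → Obs p) : ℝ :=
  ∫ z, P.freshRisk lam η J (D, z) ∂ν

variable {P : Problem p} {ν : Measure (Obs p)}

theorem Problem.Admissible.measurable_freshRisk (hP : P.Admissible s C C_X B) (hlam : 0 < lam)
    (hη : η ∈ Set.Ioo (0 : ℝ) 1) (J : Finset (Fin n)) : Measurable (P.freshRisk lam η J) := by
  have hm := hP.measurable_estimate hlam hη J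
  have : Measurable fun q : (Fin n → Obs p) × Obs p =>
      (q.2.2, inner ℝ q.2.1 (P.estimate lam η J q.1)) := by fun_prop
  exact hP.risk.measurable.comp this

theorem Problem.Admissible.measurable_riskAt (hP : P.Admissible s C C_X B) (hlam : 0 < lam)
    (hη : η ∈ Set.Ioo (0 : ℝ) 1) (J : Finset (Fin n)) (i : Fin n) :
    Measurable (P.riskAt lam η J i) :=
  (hP.measurable_freshRisk hlam hη J).comp (measurable_id.prodMk (measurable_pi_apply i))

theorem Problem.Admissible.measurable_meanRisk [SFinite ν] (hP : P.Admissible s C C_X B)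
    (hlam : 0 < lam) (hη : η ∈ Set.Ioo (0 : ℝ) 1) (J : Finset (Fin n)) :
    Measurable (P.meanRisk lam η ν J) :=
  (StronglyMeasurable.integral_prod_right
    (f := fun (D : Fin n → Obs p) z => P.freshRisk lam η J (D, z))
    (hP.measurable_freshRisk hlam hη J).stronglyMeasurable).measurable

theorem Problem.riskAt_update {J : Finset (Fin n)} {i : Fin n} (hi : i ∉ J) (D : Fin n → Obs p)
    (z : Obs p) :
    P.riskAt lam η J i (Function.update D i z) = P.freshRisk lam η J (D, z) := by
  simp only [Problem.riskAt, Problem.freshRisk, Function.update_self, Problem.estimate_update hi]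

/-- Given the other observations, the held-out risk is unbiased for the mean risk of the same
estimate; this links LO to OO. -/
theorem Problem.coordAvg_riskAt {J : Finset (Fin n)} {i : Fin n} (hi : i ∉ J) :
    coordAvg ν i (P.riskAt lam η J i) = P.meanRisk lam η ν J := by
  ext D
  simp only [coordAvg, Problem.riskAt_update hi, Problem.meanRisk]

theorem Problem.riskAt_update_of_notMem {J : Finset (Fin n)} {i j : Fin n} (hij : i ≠ j)
    (hj : j ∉ J) (D : Fin n → Obs p) (z : Obs p) :
    P.riskAt lam η J i (Function.update D j z) = P.riskAt lam η J i D := by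
  simp only [Problem.riskAt, Function.update_of_ne hij, Problem.estimate_update hj]

variable [IsProbabilityMeasure ν]

/-- A held-out observation is distributed like a fresh one, so fresh-point bounds transfer. -/
theorem Problem.Admissible.lintegral_riskAt_sq (hP : P.Admissible s C C_X B) (hlam : 0 < lam)
    (hη : η ∈ Set.Ioo (0 : ℝ) 1) {J : Finset (Fin n)} {i : Fin n} (hi : i ∉ J) :
    ∫⁻ D, ENNReal.ofReal (P.riskAt lam η J i D ^ 2) ∂(Measure.pi fun _ => ν) =
      ∫⁻ q, ENNReal.ofReal (P.freshRisk lam η J q ^ 2) ∂((Measure.pi fun _ => ν).prod ν) := by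
  have h1 := hP.measurable_riskAt hlam hη J i
  have h2 := hP.measurable_freshRisk hlam hη J
  rw [lintegral_pi_eq_update i (by fun_prop), lintegral_prod _ (by fun_prop)]
  simp only [Problem.riskAt_update hi]

theorem Problem.Admissible.lintegral_riskAt_sub_sq (hP : P.Admissible s C C_X B) (hlam : 0 < lam)
    (hη : η ∈ Set.Ioo (0 : ℝ) 1) {J J' : Finset (Fin n)} {i : Fin n} (hi : i ∉ J) (hi' : i ∉ J') :
    ∫⁻ D, ENNReal.ofReal ((P.riskAt lam η J i D - P.riskAt lam η J' i D) ^ 2)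
        ∂(Measure.pi fun _ => ν) =
      ∫⁻ q, ENNReal.ofReal ((P.freshRisk lam η J q - P.freshRisk lam η J' q) ^ 2)
        ∂((Measure.pi fun _ => ν).prod ν) := by
  have h1 := hP.measurable_riskAt hlam hη J i
  have h2 := hP.measurable_freshRisk hlam hη J
  have h1' := hP.measurable_riskAt hlam hη J' i
  have h2' := hP.measurable_freshRisk hlam hη J'
  rw [lintegral_pi_eq_update i (by fun_prop), lintegral_prod _ (by fun_prop)]
  simp only [Problem.riskAt_update hi, Problem.riskAt_update hi']

theorem Problem.Admissible.lintegral_meanRisk_sub_sq_le (hP : P.Admissible s C C_X B)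
    (hlam : 0 < lam) (hη : η ∈ Set.Ioo (0 : ℝ) 1) {J J' : Finset (Fin n)}
    (hJ : Integrable (P.freshRisk lam η J) ((Measure.pi fun _ => ν).prod ν))
    (hJ' : Integrable (P.freshRisk lam η J') ((Measure.pi fun _ => ν).prod ν)) :
    ∫⁻ D, ENNReal.ofReal ((P.meanRisk lam η ν J D - P.meanRisk lam η ν J' D) ^ 2)
        ∂(Measure.pi fun _ => ν) ≤
      ∫⁻ q, ENNReal.ofReal ((P.freshRisk lam η J q - P.freshRisk lam η J' q) ^ 2)
        ∂((Measure.pi fun _ => ν).prod ν) := by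
  have h2 := hP.measurable_freshRisk hlam hη J
  have h2' := hP.measurable_freshRisk hlam hη J'
  rw [lintegral_prod _ (by fun_prop)]
  refine lintegral_mono_ae ?_
  filter_upwards [hJ.prod_right_ae, hJ'.prod_right_ae] with D hD hD'
  have : P.meanRisk lam η ν J D - P.meanRisk lam η ν J' D =
      ∫ z, P.freshRisk lam η J (D, z) - P.freshRisk lam η J' (D, z) ∂ν :=
    (integral_sub hD hD').symm
  rw [this]
  exact ofReal_integral_sq_le (by fun_prop)

end ProductSpace

/-- The difference between the leave-one-out estimate and the out-of-sample risk, as a function of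
the training set. -/
noncomputable def Problem.looError {n p : ℕ} (P : Problem p) (lam η : ℝ) (ν : Measure (Obs p))
    (D : Fin n → Obs p) : ℝ :=
  (1 / (n : ℝ)) * ∑ i, P.riskAt lam η (Finset.univ.erase i) i D -
    P.meanRisk lam η ν Finset.univ D

theorem exists_looError_sq_bound (h : ValidParams γ₀ lam η s C C_X B) (C_Y : ℝ → ℝ) :
    ∃ K : ℝ, 0 ≤ K ∧ ∀ (n p : ℕ) (P : Problem p) (ν : Measure (Obs p)),
      P.IsSetting γ₀ s C C_X B C_Y n ν →
      Measurable (P.looError (n := n) lam η ν) ∧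
      Integrable (fun D : Fin n → Obs p => P.looError lam η ν D ^ 2) (Measure.pi fun _ => ν) ∧
      ∫ D : Fin n → Obs p, P.looError lam η ν D ^ 2 ∂(Measure.pi fun _ => ν) ≤ K / n := by
  obtain ⟨K, hK0, hK⟩ := exists_risk_moment_bound h C_Y
  obtain ⟨L, hL0, hL⟩ := exists_risk_sub_bound h C_Y
  have hlam := h.lam_pos
  have hη := h.eta_mem
  -- From `2 * ((4K + 4L) + L)`: the bounds for `A` and `R`, combined by `(A + R)² ≤ 2 (A² + R²)`.
  refine ⟨8 * K + 10 * L, by positivity, fun n p P ν hset => ?_⟩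
  have hKJ := hK n p P ν hset
  have hLJ := hL n p P ν hset
  have hn := hset.sampleSize_ne_zero h.ratio_pos
  have hP := hset.admissible
  have := hset.law.isProbabilityMeasure
  have hn' : (0 : ℝ) < n := by positivity
  have hLn : 0 ≤ L / n := by positivity
  set π : Measure (Fin n → Obs p) := Measure.pi fun _ => ν
  change ∀ J : Finset (Fin n), ∫⁻ q, ENNReal.ofReal (P.freshRisk lam η J q ^ 2) ∂(π.prod ν) ≤ _
    at hKJ
  change ∀ (J : Finset (Fin n)) (j : Fin n), j ∉ J → ∫⁻ q, ENNReal.ofReal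
    ((P.freshRisk lam η J q - P.freshRisk lam η (insert j J) q) ^ 2) ∂(π.prod ν) ≤ _ at hLJ
  have hfm := fun J : Finset (Fin n) => hP.measurable_freshRisk hlam hη J
  have hrm := fun (J : Finset (Fin n)) i => hP.measurable_riskAt hlam hη J i
  have hmm := fun J : Finset (Fin n) => hP.measurable_meanRisk (ν := ν) hlam hη J
  have hfint : ∀ J : Finset (Fin n), Integrable (P.freshRisk lam η J) (π.prod ν) := fun J =>
    (memLp_two_of_lintegral_sq_le (hfm J) (hKJ J)).integrable one_le_two
  set A : (Fin n → Obs p) → ℝ := fun D => (1 / (n : ℝ)) * ∑ i : Fin n,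
    (P.riskAt lam η (Finset.univ.erase i) i D -
      coordAvg ν i (P.riskAt lam η (Finset.univ.erase i) i) D)
  set R : (Fin n → Obs p) → ℝ := fun D => ∑ i : Fin n, (1 / (n : ℝ)) *
    (P.meanRisk lam η ν (Finset.univ.erase i) D - P.meanRisk lam η ν Finset.univ D)
  have hAm : Measurable A := (Finset.measurable_sum _ fun i _ =>
    (hrm _ i).sub (measurable_coordAvg i (hrm _ i))).const_mul _
  have hRm : Measurable R := Finset.measurable_sum _ fun i _ =>
    ((hmm _).sub (hmm _)).const_mul _
  have hdecomp : ∀ D, P.looError lam η ν D = A D + R D := by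
    intro D
    simp only [Problem.looError, A, R, Problem.coordAvg_riskAt (Finset.notMem_erase _ _)]
    rw [← Finset.mul_sum, ← mul_add, ← Finset.sum_add_distrib]
    simp only [sub_add_sub_cancel, Finset.sum_sub_distrib, Finset.sum_const, Finset.card_univ,
      Fintype.card_fin, nsmul_eq_mul]
    field_simp
  have hF2 : ∀ i (J : Finset (Fin n)), i ∉ J →
      ∫⁻ D, ENNReal.ofReal (P.riskAt lam η J i D ^ 2) ∂π ≤ ENNReal.ofReal K := fun i J hi =>
    (hP.lintegral_riskAt_sq hlam hη hi).trans_le (hKJ J)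
  have hA2 : ∫ D, A D ^ 2 ∂π ≤ 4 * K / n + 4 * (L / n) := by
    -- The surrogate free of coordinate `j` is the risk at `i` of the leave-two-out estimate.
    refine integral_sq_mean_sub_coordAvg_le (ν := ν)
      (F := fun i => P.riskAt lam η (Finset.univ.erase i) i)
      (F' := fun i j => P.riskAt lam η ((Finset.univ.erase i).erase j) i) hK0 hLn
      (fun i => hrm _ i) (fun i j => hrm _ i) (fun i => hF2 i _ (Finset.notMem_erase _ _))
      (fun i j => hF2 i _ (by simp)) (fun i j hij D z =>
        Problem.riskAt_update_of_notMem hij (Finset.notMem_erase _ _) D z) (fun i j hij => ?_) hn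
    rw [hP.lintegral_riskAt_sub_sq hlam hη (Finset.notMem_erase _ _) (by simp)]
    have h1 := hLJ ((Finset.univ.erase i).erase j) j (Finset.notMem_erase _ _)
    rw [Finset.insert_erase (by simp [hij.symm])] at h1
    simpa only [sub_sq_comm (P.freshRisk lam η (Finset.univ.erase i) _)] using h1
  have hTL : ∀ i : Fin n, MemLp (fun D => P.riskAt lam η (Finset.univ.erase i) i D -
      coordAvg ν i (P.riskAt lam η (Finset.univ.erase i) i) D) 2 π := fun i => by
    have h1 := memLp_two_of_lintegral_sq_le (hrm _ i)
      (hF2 i (Finset.univ.erase i) (Finset.notMem_erase _ _))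
    exact h1.sub (memLp_coordAvg i (hrm _ i) h1)
  have hAL : MemLp A 2 π := by
    have h1 := memLp_finsetSum Finset.univ fun i _ => hTL i
    exact h1.const_mul (1 / (n : ℝ))
  have hR2 : ∫⁻ D, ENNReal.ofReal (R D ^ 2) ∂π ≤ ENNReal.ofReal (L / n) := by
    have hpt : ∀ D, R D ^ 2 ≤ (∑ i : Fin n, (1 / (n : ℝ)) *
        |P.meanRisk lam η ν (Finset.univ.erase i) D - P.meanRisk lam η ν Finset.univ D|) ^ 2 := by
      intro D
      rw [← sq_abs]
      refine pow_le_pow_left₀ (abs_nonneg _) ((Finset.abs_sum_le_sum_abs _ _).trans_eq ?_) 2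
      simp only [abs_mul, abs_of_nonneg (one_div_nonneg.2 hn'.le)]
    refine (lintegral_ofReal_mono hpt).trans ?_
    have hum : ∀ i : Fin n, Measurable fun D : Fin n → Obs p =>
        |P.meanRisk lam η ν (Finset.univ.erase i) D - P.meanRisk lam η ν Finset.univ D| :=
      fun i => ((hmm _).sub (hmm _)).abs
    have hui : ∀ i : Fin n, ∫⁻ D, ENNReal.ofReal (|P.meanRisk lam η ν (Finset.univ.erase i) D -
        P.meanRisk lam η ν Finset.univ D| ^ 2) ∂π ≤ ENNReal.ofReal (L / n) := by
      intro i
      simp only [sq_abs]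
      have h1 := hLJ (Finset.univ.erase i) i (Finset.notMem_erase _ _)
      rw [Finset.insert_erase (Finset.mem_univ i)] at h1
      exact (hP.lintegral_meanRisk_sub_sq_le hlam hη (hfint _) (hfint _)).trans h1
    exact lintegral_mean_pow_le hn hum (fun i D => abs_nonneg _) 2 hLn hui
  have hRL : MemLp R 2 π := memLp_two_of_lintegral_sq_le hRm hR2
  have hR2' : ∫ D, R D ^ 2 ∂π ≤ L / n :=
    integral_le_of_lintegral_ofReal_le (hRm.pow_const 2) hLn (fun _ => sq_nonneg _) hR2
  have hfun : P.looError lam η ν = fun D => A D + R D := funext hdecomp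
  have hHL : MemLp (P.looError lam η ν) 2 π := hfun ▸ hAL.add hRL
  refine ⟨hfun ▸ hAm.add hRm, hHL.integrable_sq, ?_⟩
  calc ∫ D, P.looError lam η ν D ^ 2 ∂π ≤ ∫ D, 2 * (A D ^ 2 + R D ^ 2) ∂π := by
        refine integral_mono hHL.integrable_sq
          ((hAL.integrable_sq.add hRL.integrable_sq).const_mul 2) fun D => ?_
        simp only [hdecomp]
        nlinarith [sq_nonneg (A D - R D)]
    _ ≤ 2 * ((4 * K / n + 4 * (L / n)) + L / n) := by
        rw [integral_const_mul, integral_add hAL.integrable_sq hRL.integrable_sq]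
        linarith
    _ = _ := by ring

/-! ### Transfer to the sample space -/

section Sample

variable {n p : ℕ} {P : Problem p} {Ω : Type*} [MeasurableSpace Ω] {μ : Measure Ω}
  [IsProbabilityMeasure μ] {Z : Fin (n + 1) → Ω → Obs p}

theorem Problem.IsSample.isLaw (hZ : P.IsSample C_Y μ Z) : P.IsLaw C_Y (μ.map (Z 0)) := by
  have hm := hZ.measurable 0
  refine ⟨Measure.isProbabilityMeasure_map hm.aemeasurable, ?_, fun m h0 => ?_⟩
  · rw [Measure.map_map measurable_fst hm]
    exact (hZ.features 0).map_eq
  · have hf : Measurable fun z : Obs p => |z.2| ^ m := by fun_prop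
    rw [integrable_map_measure hf.aestronglyMeasurable hm.aemeasurable,
      integral_map hm.aemeasurable hf.aestronglyMeasurable]
    exact hZ.moments 0 m h0

theorem measurable_train (hZ : ∀ i, Measurable (Z i)) : Measurable (train Z) :=
  measurable_pi_lambda _ fun i => hZ i.succ

theorem Problem.IsSample.map_prod (hZ : P.IsSample C_Y μ Z) :
    μ.map (fun ω => (train Z ω, Z 0 ω)) =
      (Measure.pi fun _ => μ.map (Z 0)).prod (μ.map (Z 0)) := by
  have hm := hZ.measurable
  have := hZ.isLaw.isProbabilityMeasure
  have h1 := hZ.indep.map_fun_eq_pi_map fun i => (hm i).aemeasurable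
  have h2 : ∀ i, μ.map (Z i) = μ.map (Z 0) := fun i => (hZ.identDistrib i).map_eq
  simp only [h2] at h1
  have h3 := (measurePreserving_piFinSuccAbove (fun _ : Fin (n + 1) => μ.map (Z 0)) 0).map_eq
  rw [← h1, Measure.map_map (MeasurableEquiv.measurable _) (measurable_pi_lambda _ hm)] at h3
  rw [← Measure.prod_swap, ← h3, Measure.map_map measurable_swap]
  · rfl
  · exact (MeasurableEquiv.measurable _).comp (measurable_pi_lambda _ hm)

theorem Problem.IsSample.map_train (hZ : P.IsSample C_Y μ Z) :
    μ.map (train Z) = Measure.pi fun _ => μ.map (Z 0) := by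
  have := hZ.isLaw.isProbabilityMeasure
  have h := congrArg (Measure.map Prod.fst) hZ.map_prod
  rw [Measure.map_map measurable_fst ((measurable_train hZ.measurable).prodMk (hZ.measurable 0)),
    Measure.map_fst_prod, measure_univ, one_smul] at h
  exact h

/-- The test point is independent of the training set, so its conditional law is the constant kernel
and the conditional expectation is an integral over a fresh observation. -/
theorem Problem.IsSample.OO_ae_eq (hZ : P.IsSample C_Y μ Z)
    (hint : Integrable (P.freshRisk (n := n) lam η Finset.univ)
      ((Measure.pi fun _ => μ.map (Z 0)).prod (μ.map (Z 0)))) :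
    P.OO lam η μ Z =ᵐ[μ] fun ω => P.meanRisk lam η (μ.map (Z 0)) Finset.univ (train Z ω) := by
  have hm := measurable_train hZ.measurable
  have := hZ.isLaw.isProbabilityMeasure
  rw [← hZ.map_prod] at hint
  have h1 := condExp_prod_ae_eq_integral_condDistrib' hm (hZ.measurable 0).aemeasurable hint
  have h2 : condDistrib (Z 0) (train Z) μ =ᵐ[μ.map (train Z)] Kernel.const _ (μ.map (Z 0)) := by
    refine condDistrib_ae_eq_of_measure_eq_compProd _ (hZ.measurable 0).aemeasurable ?_
    rw [Measure.compProd_const, hZ.map_prod, hZ.map_train]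
  have h3 := ae_of_ae_map hm.aemeasurable h2
  refine EventuallyEq.trans h1 ?_
  filter_upwards [h3] with ω hω
  rw [hω]
  rfl

end Sample

theorem exists_sq_error_bound (h : ValidParams γ₀ lam η s C C_X B) (C_Y : ℝ → ℝ) :
    ∃ K : ℝ, ∀ (n p : ℕ), (n : ℝ) / p = γ₀ → ∀ (P : Problem p), P.Admissible s C C_X B →
      ∀ (Ω : Type*) [MeasurableSpace Ω] (μ : Measure Ω) [IsProbabilityMeasure μ]
        (Z : Fin (n + 1) → Ω → Obs p), P.IsSample C_Y μ Z →
      Integrable (fun ω => (P.LO lam η Z ω - P.OO lam η μ Z ω) ^ 2) μ ∧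
        ∫ ω, (P.LO lam η Z ω - P.OO lam η μ Z ω) ^ 2 ∂μ ≤ K / n := by
  obtain ⟨K, -, hK⟩ := exists_looError_sq_bound h C_Y
  obtain ⟨L, -, hL⟩ := exists_risk_moment_bound h C_Y
  refine ⟨K, fun n p hratio P hP Ω _ μ _ Z hZ => ?_⟩
  have hset : P.IsSetting γ₀ s C C_X B C_Y n (μ.map (Z 0)) := ⟨hratio, hP, hZ.isLaw⟩
  obtain ⟨hm, hint, hle⟩ := hK n p P _ hset
  have hf := (memLp_two_of_lintegral_sq_le
    (hP.measurable_freshRisk (n := n) h.lam_pos h.eta_mem Finset.univ)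
    (hL n p P _ hset Finset.univ))
  have := hZ.isLaw.isProbabilityMeasure
  have hOO := hZ.OO_ae_eq (hf.integrable one_le_two)
  have hae : (fun ω => (P.LO lam η Z ω - P.OO lam η μ Z ω) ^ 2) =ᵐ[μ]
      fun ω => P.looError lam η (μ.map (Z 0)) (train Z ω) ^ 2 := by
    filter_upwards [hOO] with ω hω
    rw [hω]
    rfl
  have ht := (measurable_train hZ.measurable).aemeasurable (μ := μ)
  rw [← hZ.map_train] at hint hle
  refine ⟨(integrable_congr hae).2
    ((integrable_map_measure (hm.pow_const 2).aestronglyMeasurable ht).1 hint), ?_⟩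
  rw [integral_congr_ae hae]
  rwa [integral_map ht (hm.pow_const 2).aestronglyMeasurable] at hle

/-- A second-moment bound of order `1 / n` implies convergence to zero in probability. -/
theorem tendsto_measure_ge_of_integral_sq_le {Ω : ℕ → Type*} [∀ k, MeasurableSpace (Ω k)]
    {μ : ∀ k, Measure (Ω k)} [∀ k, IsProbabilityMeasure (μ k)] {X : ∀ k, Ω k → ℝ} {n : ℕ → ℕ}
    (hn : Tendsto n atTop atTop) {K : ℝ} (hint : ∀ k, Integrable (fun ω => X k ω ^ 2) (μ k))
    (hle : ∀ k, ∫ ω, X k ω ^ 2 ∂(μ k) ≤ K / n k) {ε : ℝ} (hε : 0 < ε) :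
    Tendsto (fun k => μ k {ω | ε ≤ |X k ω|}) atTop (𝓝 0) := by
  have hbound : ∀ k, μ k {ω | ε ≤ |X k ω|} ≤ ENNReal.ofReal (K / ε ^ 2 / n k) := by
    intro k
    have h1 := mul_meas_ge_le_integral_of_nonneg
      (Eventually.of_forall fun ω => sq_nonneg (X k ω)) (hint k) (ε ^ 2)
    have hset : {ω | ε ^ 2 ≤ X k ω ^ 2} = {ω | ε ≤ |X k ω|} := by
      ext ω
      rw [Set.mem_ofPred_eq, Set.mem_ofPred_eq, ← sq_abs (X k ω),
        pow_le_pow_iff_left₀ hε.le (abs_nonneg _) two_ne_zero]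
    rw [hset] at h1
    rw [← ofReal_measureReal]
    refine ENNReal.ofReal_le_ofReal ?_
    rw [div_right_comm, le_div_iff₀ (by positivity), mul_comm]
    exact h1.trans (hle k)
  refine tendsto_of_tendsto_of_tendsto_of_le_of_le tendsto_const_nhds ?_ (fun _ => zero_le) hbound
  rw [← ENNReal.ofReal_zero]
  exact ENNReal.tendsto_ofReal
    (tendsto_const_nhds.div_atTop (tendsto_natCast_atTop_atTop.comp hn))

end LeaveOneOut

theorem theorem1 (γ₀ lam η s C C_X B : ℝ) (C_Y : ℝ → ℝ)
    (hγ₀ : 0 < γ₀) (hlam : 0 < lam) (hη : η ∈ Set.Ioo (0 : ℝ) 1) (hs : 0 ≤ s) (hC : 0 < C)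
    (hC_X : 0 < C_X) (hB : 0 ≤ B) :
    -- the bound, with a constant that depends only on the parameters above
    (∃ C_v : ℝ, ∀ (n p : ℕ), (n : ℝ) / p = γ₀ →
      ∀ (P : LeaveOneOut.Problem p), P.Admissible s C C_X B →
      ∀ (Ω : Type*) [MeasurableSpace Ω] (μ : Measure Ω) [IsProbabilityMeasure μ]
        (Z : Fin (n + 1) → Ω → LeaveOneOut.Obs p), P.IsSample C_Y μ Z →
      Integrable (fun ω => (P.LO lam η Z ω - P.OO lam η μ Z ω) ^ 2) μ ∧
        ∫ ω, (P.LO lam η Z ω - P.OO lam η μ Z ω) ^ 2 ∂μ ≤ C_v / n) ∧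
    -- consistency along every sequence of problems with growing sample size
    (∀ (n p : ℕ → ℕ), (∀ k, (n k : ℝ) / p k = γ₀) → Tendsto n atTop atTop →
      ∀ (P : ∀ k, LeaveOneOut.Problem (p k)), (∀ k, (P k).Admissible s C C_X B) →
      ∀ (Ω : ℕ → Type*) [∀ k, MeasurableSpace (Ω k)] (μ : ∀ k, Measure (Ω k))
        [∀ k, IsProbabilityMeasure (μ k)]
        (Z : ∀ k, Fin (n k + 1) → Ω k → LeaveOneOut.Obs (p k)),
        (∀ k, (P k).IsSample C_Y (μ k) (Z k)) →
      ∀ ε : ℝ, 0 < ε →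
        Tendsto (fun k => μ k {ω | ε ≤ |(P k).LO lam η (Z k) ω - (P k).OO lam η (μ k) (Z k) ω|})
          atTop (𝓝 0)) := by
  have h : LeaveOneOut.ValidParams γ₀ lam η s C C_X B := ⟨hγ₀, hlam, hη, hs, hC, hC_X, hB⟩
  refine ⟨LeaveOneOut.exists_sq_error_bound h C_Y, ?_⟩
  intro n p hratio hn P hP Ω _ μ _ Z hZ ε hε
  -- The bound is invoked anew because these sample spaces live in a different universe from those
  -- of the first part.
  obtain ⟨K, hK⟩ := LeaveOneOut.exists_sq_error_bound h C_Y
  exact LeaveOneOut.tendsto_measure_ge_of_integral_sq_le hn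
    (fun k => (hK (n k) (p k) (hratio k) (P k) (hP k) (Ω k) (μ k) (Z k) (hZ k)).1)
    (fun k => (hK (n k) (p k) (hratio k) (P k) (hP k) (Ω k) (μ k) (Z k) (hZ k)).2) hε
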